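/- Let $S^\infty$ be the graph on $\mathbb{Z}^2$ in which two distinct points $u=(u_x,u_y)$ and $v=(v_x,v_y)$ are adjacent if and only if $|u_x-v_x|\le 1$ and $|u_y-v_y|\le 1$. Let $m,n,k,l$ be integers with $m,n>1$, $1\le k<m$ and $1\le l<n$, and let $L(m,n;k,l)$ be the subgraph of $S^\infty$ induced by the set of points $(x,y)$ with $1\le x\le m$, $1\le y\le n$ and not both $x>m-k$ and $y\le l$ (that is, the $m\times n$ rectangle, with $(1,1)$ as its upper-left corner and $y$ increasing downwards, with a $k\times l$ rectangle removed from its upper-right corner). Call a set $S$ of vertices of a graph $G$ a vertex cut if $G-S$ is disconnected, and a vertex $v$ a cut vertex if $\{v\}$ is a vertex cut. Theorem. Let $s$ and $t$ be distinct vertices of $L(m,n;k,l)$. Then $L(m,n;k,l)$ has a Hamiltonian path with endpoints $s$ and $t$ if and only if none of the following three conditions holds: (F1) $s$ or $t$ is a cut vertex of $L(m,n;k,l)$, or $\{s,t\}$ is a vertex cut of $L(m,n;k,l)$; (F4) some vertex $w\notin\{s,t\}$ has degree $1$ in $L(m,n;k,l)$; (F5) either $m-k=1$, $n-l=2$, $l=1$,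 $k\ge 2$ and $\{s,t\}$ is $\{(1,2),(2,3)\}$ or $\{(1,3),(2,2)\}$; or, symmetrically (under the reflection $(x,y)\mapsto(n+1-y,\,m+1-x)$, which maps $L(m,n;k,l)$ onto $L(n,m;l,k)$), $n-l=1$, $m-k=2$, $k=1$, $l\ge 2$ and $\{s,t\}$ is $\{(1,n-1),(2,n)\}$ or $\{(1,n),(2,n-1)\}$. -/

import Mathlib

/-- The infinite graph `S^∞` on the integer points of the plane: two distinct points are adjacent
when each of their coordinates differs by at most one (eight neighbours). -/
def supergrid : SimpleGraph (ℤ × ℤ) where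
  Adj u v := u ≠ v ∧ |u.1 - v.1| ≤ 1 ∧ |u.2 - v.2| ≤ 1
  symm := ⟨fun u v h => ⟨h.1.symm, by rw [abs_sub_comm]; exact h.2.1,
    by rw [abs_sub_comm]; exact h.2.2⟩⟩
  loopless := ⟨fun _ h => h.1 rfl⟩

/-- The vertices of the rectangular supergrid graph `R(m, n)`: `m` columns and `n` rows. The
upper-left corner is `(1, 1)`, so second coordinates increase downwards. -/
def rectVerts (m n : ℕ) : Set (ℤ × ℤ) :=
  {v | 1 ≤ v.1 ∧ v.1 ≤ m ∧ 1 ≤ v.2 ∧ v.2 ≤ n}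

/-- The vertices of `L(m, n; k, l)`: those of `R(m, n)` outside the copy of `R(k, l)` in its
upper-right corner (the last `k` columns, the first `l` rows). -/
def lShapeVerts (m n k l : ℕ) : Set (ℤ × ℤ) :=
  rectVerts m n \ {v | (v.1 - ((m : ℤ) - k), v.2) ∈ rectVerts k l}

/-- The `L`-shaped supergrid graph `L(m, n; k, l)`, as an induced subgraph of `S^∞`. -/
def lShape (m n k l : ℕ) : SimpleGraph (lShapeVerts m n k l) :=
  supergrid.induce (lShapeVerts m n k l)

/-- `S` is a vertex cut of `G`: the graph `G - S` is disconnected. -/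
def IsVertexCut {V : Type*} (G : SimpleGraph V) (S : Set V) : Prop :=
  ¬ (G.induce Sᶜ).Preconnected

/-- `v` is a cut vertex of `G`. -/
def IsCutVertex {V : Type*} (G : SimpleGraph V) (v : V) : Prop :=
  IsVertexCut G {v}

/-- Condition (F1): `s` or `t` is a cut vertex, or `{s, t}` is a vertex cut. -/
def CondF1 {V : Type*} (G : SimpleGraph V) (s t : V) : Prop :=
  IsCutVertex G s ∨ IsCutVertex G t ∨ IsVertexCut G {s, t}

/-- Condition (F4): some vertex other than `s` and `t` has degree one. -/
def CondF4 {V : Type*} (G : SimpleGraph V) (s t : V) : Prop :=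
  ∃ w : V, (G.neighborSet w).encard = 1 ∧ w ≠ s ∧ w ≠ t

/-- Condition (F5), for points `s`, `t` of `L(m, n; k, l)`: `m - k = 1`, `n - l = 2`, `l = 1`,
`k ≥ 2` and the stated pairs, or the mirror image of this under the reflection
`(x, y) ↦ (n + 1 - y, m + 1 - x)`, which carries `L(m, n; k, l)` onto `L(n, m; l, k)`. -/
def CondF5 (m n k l : ℕ) (s t : ℤ × ℤ) : Prop :=
  (m = k + 1 ∧ n = l + 2 ∧ l = 1 ∧ 2 ≤ k ∧
    (({s, t} : Set (ℤ × ℤ)) = {(1, 2), (2, 3)} ∨ ({s, t} : Set (ℤ × ℤ)) = {(1, 3), (2, 2)})) ∨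
  (n = l + 1 ∧ m = k + 2 ∧ k = 1 ∧ 2 ≤ l ∧
    (({s, t} : Set (ℤ × ℤ)) = {(1, (n : ℤ) - 1), (2, (n : ℤ))} ∨
      ({s, t} : Set (ℤ × ℤ)) = {(1, (n : ℤ)), (2, (n : ℤ) - 1)}))

/-!
Paths are represented by `Traverses A s t`: some path of the supergrid from `s` to `t` visits
exactly the points of the set `A`. Traversals of disjoint sets are concatenated
(`Traverses.append`), and an edge of a traversal is replaced by a detour through a disjoint set
(`Via.insert`), where `Via A s t u v` says that a traversal can be chosen to use the edge `uv`.

Necessity of the conditions: removing an end, or both ends, from a path leaves a path, so neither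
is a vertex cut; an inner point of a path has two neighbours; and for the pairs in `CondF5` the
first steps of the path are forced until it gets stuck (`Traverses.not_twisted`).

Sufficiency rests on rectangles. The central statement is `cornerLinked`: with few exceptions, two
points of a rectangle are the ends of a traversal which uses the horizontal edge in the upper left
corner. Strips of two rows are traversed explicitly, and larger rectangles are treated by
induction, cutting off two rows or two columns. By reflection, any two points that do not separate
the rectangle are the ends of a traversal (`rectLinked`), and in a rectangle of width at least
three this traversal can use some edge of the first row (`CornerLinked.exists_top_edge`).

An `L`-shape is a rectangle with another one, its upper part, on top of its first columns. If both
parts have at least two rows and two columns, then the traversal passes once between the two parts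
if the ends lie in different ones, and otherwise it arises from a traversal of the part with both
ends by a detour through the other part; the few pairs for which the required edge is not available
have explicit solutions.

The reflection `reflectL` exchanges the two arms, so an upper part of one row is no problem as long
as the removed rectangle has at least two columns. If a single corner is removed, then this corner
is dropped from a traversal of the full rectangle, since its neighbours form a clique
(`RectLinked.cornerless`). If the upper part is a single column, then either the path starts or
ends with this column, or the column is a single point, which is inserted into the corner edge of
the rectangle below it. Vertex cuts aside, the pairs in `CondF5` are those for which this edge is
not available.
-/

/-! ### Traversals of sets of grid points -/

/-- `Traverses A s t`: some path of the supergrid starts at `s`, ends at `t` and visits exactly the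
points of `A`, each of them once. -/
inductive Traverses : Set (ℤ × ℤ) → ℤ × ℤ → ℤ × ℤ → Prop
  | single (v : ℤ × ℤ) : Traverses {v} v v
  | cons {A : Set (ℤ × ℤ)} {u v w : ℤ × ℤ} : u ∉ A → supergrid.Adj u v → Traverses A v w →
      Traverses (insert u A) u w

/-- The points with first coordinate in `[a, b]` and second coordinate in `[c, d]`. -/
def box (a b c d : ℤ) : Set (ℤ × ℤ) :=
  {v | a ≤ v.1 ∧ v.1 ≤ b ∧ c ≤ v.2 ∧ v.2 ≤ d}

/-- The vertex set of an `L`-shaped graph: `m` columns and `n` rows, where only the first `a`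
columns reach into the first `l` rows. -/
def ell (m a l n : ℤ) : Set (ℤ × ℤ) :=
  {v | 1 ≤ v.1 ∧ v.1 ≤ m ∧ 1 ≤ v.2 ∧ v.2 ≤ n ∧ (v.1 ≤ a ∨ l < v.2)}

theorem mem_box {a b c d x y : ℤ} :
    (x, y) ∈ box a b c d ↔ a ≤ x ∧ x ≤ b ∧ c ≤ y ∧ y ≤ d := Iff.rfl

theorem mem_ell {m a l n x y : ℤ} :
    (x, y) ∈ ell m a l n ↔ 1 ≤ x ∧ x ≤ m ∧ 1 ≤ y ∧ y ≤ n ∧ (x ≤ a ∨ l < y) := Iff.rfl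

theorem supergrid_adj {a b c d : ℤ} : supergrid.Adj (a, b) (c, d) ↔
    (a ≠ c ∨ b ≠ d) ∧ a - c ≤ 1 ∧ c - a ≤ 1 ∧ b - d ≤ 1 ∧ d - b ≤ 1 := by
  simp only [supergrid, ne_eq, Prod.mk.injEq, abs_le]
  omega

theorem Traverses.start_mem {A : Set (ℤ × ℤ)} {s t : ℤ × ℤ} (h : Traverses A s t) : s ∈ A := by
  cases h <;> simp

theorem Traverses.end_mem {A : Set (ℤ × ℤ)} {s t : ℤ × ℤ} (h : Traverses A s t) : t ∈ A := by
  induction h with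
  | single v => simp
  | cons _ _ _ ih => exact Set.mem_insert_of_mem _ ih

/-- Two traversals of disjoint sets are joined by an edge between the end of the first and the
start of the second. -/
theorem Traverses.join {A B : Set (ℤ × ℤ)} {s p q t : ℤ × ℤ} (hA : Traverses A s p)
    (hB : Traverses B q t) (hpq : supergrid.Adj p q) (hAB : ∀ x ∈ A, x ∉ B) :
    Traverses (A ∪ B) s t := by
  induction hA with
  | single v => exact .cons (hAB v rfl) hpq hB
  | @cons A u v w hu huv hA ih =>
    rw [Set.insert_union]
    refine .cons ?_ huv (ih hpq fun x hx => hAB x (Set.mem_insert_of_mem _ hx))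
    rintro (h | h)
    exacts [hu h, hAB u (Set.mem_insert _ _) h]

theorem Traverses.symm {A : Set (ℤ × ℤ)} {s t : ℤ × ℤ} (h : Traverses A s t) :
    Traverses A t s := by
  induction h with
  | single v => exact .single v
  | @cons A u v w hu huv hA ih =>
    have := ih.join (.single u) huv.symm (by rintro x hx rfl; exact hu hx)
    rwa [Set.union_singleton] at this

/-- `Traverses.join` with the side conditions discharged in coordinates. -/
theorem Traverses.append {A B : Set (ℤ × ℤ)} {s p q t : ℤ × ℤ} (hA : Traverses A s p)
    (hB : Traverses B q t)
    (hpq : supergrid.Adj p q := by simp only [supergrid_adj]; omega)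
    (hAB : ∀ x y, (x, y) ∈ A → (x, y) ∈ B → False := by
      intro x y
      simp only [Set.mem_union, Set.mem_sdiff, Set.mem_singleton_iff, Prod.mk.injEq, mem_box]
      omega) :
    Traverses (A ∪ B) s t :=
  hA.join hB hpq fun x hx hx' => hAB x.1 x.2 hx hx'

theorem Traverses.congr {A B : Set (ℤ × ℤ)} {s t s' t' : ℤ × ℤ} (h : Traverses A s t)
    (hs : s = s' := by first | rfl | (simp only [Prod.mk.injEq, true_and, and_true]; omega))
    (ht : t = t' := by first | rfl | (simp only [Prod.mk.injEq, true_and, and_true]; omega))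
    (hAB : ∀ x y, (x, y) ∈ A ↔ (x, y) ∈ B := by
      intro x y
      first
        | exact Iff.rfl
        | simp only [Set.mem_union, Set.mem_sdiff, Set.mem_singleton_iff, Prod.mk.injEq, mem_box,
            mem_ell]
          omega) :
    Traverses B s' t' := by
  subst hs ht
  rwa [show B = A from Set.ext fun x => (hAB x.1 x.2).symm]

/-- Adjacency-preserving bijections of the grid carry traversals to traversals. -/
theorem Traverses.map {A : Set (ℤ × ℤ)} {s t : ℤ × ℤ} (f g : ℤ × ℤ → ℤ × ℤ)
    (hgf : ∀ x, g (f x) = x) (hfg : ∀ x, f (g x) = x)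
    (hf : ∀ x y, supergrid.Adj x y → supergrid.Adj (f x) (f y)) (h : Traverses A s t) :
    Traverses (g ⁻¹' A) (f s) (f t) := by
  have hfi : Function.Injective f := Function.LeftInverse.injective hgf
  rw [← Set.image_eq_preimage_of_inverse hgf hfg]
  induction h with
  | single v => simpa using Traverses.single (f v)
  | @cons A u v w hu huv hA ih =>
    rw [Set.image_insert_eq]
    exact .cons (by simpa [hfi.eq_iff] using hu) (hf _ _ huv) ih

/-- A traversal splits at each of its inner points. -/
theorem Traverses.split {A : Set (ℤ × ℤ)} {s t z : ℤ × ℤ} (h : Traverses A s t) (hz : z ∈ A)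
    (hzs : z ≠ s) (hzt : z ≠ t) :
    ∃ B C p q, Traverses B s p ∧ Traverses C q t ∧ supergrid.Adj p z ∧ supergrid.Adj z q ∧
      (∀ x ∈ B, x ∉ C) ∧ z ∉ B ∧ z ∉ C ∧ A = B ∪ insert z C := by
  induction h with
  | single v => exact absurd hz hzs
  | @cons A u v w hu huv hA ih =>
    have hzA : z ∈ A := (Set.mem_insert_iff.mp hz).resolve_left hzs
    by_cases hzv : z = v
    · subst hzv
      cases hA with
      | single => exact absurd rfl hzt
      | @cons C _ q _ hzC hzq hC =>
        refine ⟨{u}, C, u, q, .single u, hC, huv, hzq, ?_, fun h => hzs h, hzC, ?_⟩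
        · rintro x rfl hx
          exact hu (Set.mem_insert_of_mem _ hx)
        · rw [Set.singleton_union]
    · obtain ⟨B, C, p, q, hB, hC, hp, hq, hBC, hzB, hzC, rfl⟩ := ih hzA hzv hzt
      refine ⟨insert u B, C, p, q, .cons (fun h => hu (Or.inl h)) huv hB, hC, hp, hq, ?_, ?_, hzC,
        by rw [Set.insert_union]⟩
      · rintro x (rfl | hx) hxC
        exacts [hu (Or.inr (Or.inr hxC)), hBC x hx hxC]
      · rintro (h | h)
        exacts [hzs h, hzB h]

/-- If any two distinct neighbours of an inner point `z` are adjacent, then `z` can be dropped. -/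
theorem Traverses.delete {A : Set (ℤ × ℤ)} {s t z : ℤ × ℤ} (h : Traverses A s t) (hz : z ∈ A)
    (hzs : z ≠ s) (hzt : z ≠ t)
    (hN : ∀ p ∈ A, ∀ q ∈ A, supergrid.Adj p z → supergrid.Adj z q → p ≠ q → supergrid.Adj p q) :
    Traverses (A \ {z}) s t := by
  obtain ⟨B, C, p, q, hB, hC, hp, hq, hBC, hzB, hzC, rfl⟩ := h.split hz hzs hzt
  have hpq := hN p (Or.inl hB.end_mem) q (Or.inr (Or.inr hC.start_mem)) hp hq
    (by rintro rfl; exact hBC p hB.end_mem hC.start_mem)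
  convert hB.join hC hpq hBC using 1
  ext x
  simp only [Set.mem_sdiff, Set.mem_union, Set.mem_insert_iff, Set.mem_singleton_iff]
  constructor
  · tauto
  · rintro (h | h)
    · exact ⟨Or.inl h, fun e => hzB (e ▸ h)⟩
    · exact ⟨Or.inr (Or.inr h), fun e => hzC (e ▸ h)⟩

/-- `Via A s t u v`: some traversal of `A` from `s` to `t` uses the edge between `u` and `v`, in
one of the two directions. -/
def Via (A : Set (ℤ × ℤ)) (s t u v : ℤ × ℤ) : Prop :=
  supergrid.Adj u v ∧ ∃ B C, (∀ x ∈ B, x ∉ C) ∧ A = B ∪ C ∧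
    (Traverses B s u ∧ Traverses C v t ∨ Traverses B s v ∧ Traverses C u t)

theorem Via.traverses {A : Set (ℤ × ℤ)} {s t u v : ℤ × ℤ} (h : Via A s t u v) :
    Traverses A s t := by
  obtain ⟨huv, B, C, hBC, rfl, ⟨h₁, h₂⟩ | ⟨h₁, h₂⟩⟩ := h
  exacts [h₁.join h₂ huv hBC, h₁.join h₂ huv.symm hBC]

theorem Via.swap {A : Set (ℤ × ℤ)} {s t u v : ℤ × ℤ} (h : Via A s t u v) : Via A s t v u := by
  obtain ⟨huv, B, C, hBC, hA, h⟩ := h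
  exact ⟨huv.symm, B, C, hBC, hA, h.symm⟩

theorem Via.symm {A : Set (ℤ × ℤ)} {s t u v : ℤ × ℤ} (h : Via A s t u v) : Via A t s u v := by
  obtain ⟨huv, B, C, hBC, rfl, h⟩ := h
  refine ⟨huv, C, B, fun x hC hB => hBC x hB hC, Set.union_comm _ _, ?_⟩
  rcases h with ⟨h₁, h₂⟩ | ⟨h₁, h₂⟩
  exacts [Or.inr ⟨h₂.symm, h₁.symm⟩, Or.inl ⟨h₂.symm, h₁.symm⟩]

theorem Traverses.via {A B : Set (ℤ × ℤ)} {s u v t : ℤ × ℤ} (hA : Traverses A s u)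
    (hB : Traverses B v t)
    (huv : supergrid.Adj u v := by simp only [supergrid_adj]; omega)
    (hAB : ∀ x y, (x, y) ∈ A → (x, y) ∈ B → False := by
      intro x y
      simp only [Set.mem_union, Set.mem_sdiff, Set.mem_singleton_iff, Prod.mk.injEq, mem_box]
      omega) :
    Via (A ∪ B) s t u v :=
  ⟨huv, A, B, fun x hx hx' => hAB x.1 x.2 hx hx', rfl, Or.inl ⟨hA, hB⟩⟩

theorem Via.append {A B : Set (ℤ × ℤ)} {s p q t u v : ℤ × ℤ} (hA : Via A s p u v)
    (hB : Traverses B q t)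
    (hpq : supergrid.Adj p q := by simp only [supergrid_adj]; omega)
    (hAB : ∀ x y, (x, y) ∈ A → (x, y) ∈ B → False := by
      intro x y
      simp only [Set.mem_union, Set.mem_sdiff, Set.mem_singleton_iff, Prod.mk.injEq, mem_box]
      omega) :
    Via (A ∪ B) s t u v := by
  obtain ⟨huv, C, D, hCD, rfl, h⟩ := hA
  have hDB : ∀ x ∈ D, x ∉ B := fun x hx hx' => hAB x.1 x.2 (Or.inr hx) hx'
  refine ⟨huv, C, D ∪ B, ?_, Set.union_assoc _ _ _, h.imp ?_ ?_⟩
  · rintro x hx (h | h)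
    exacts [hCD x hx h, hAB x.1 x.2 (Or.inl hx) h]
  all_goals exact fun h => ⟨h.1, h.2.join hB hpq hDB⟩

theorem Traverses.appendVia {A B : Set (ℤ × ℤ)} {s p q t u v : ℤ × ℤ} (hA : Traverses A s p)
    (hB : Via B q t u v)
    (hpq : supergrid.Adj p q := by simp only [supergrid_adj]; omega)
    (hAB : ∀ x y, (x, y) ∈ A → (x, y) ∈ B → False := by
      intro x y
      simp only [Set.mem_union, Set.mem_sdiff, Set.mem_singleton_iff, Prod.mk.injEq, mem_box]
      omega) :
    Via (A ∪ B) s t u v := by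
  rw [Set.union_comm]
  exact (hB.symm.append hA.symm hpq.symm fun x y h h' => hAB x y h' h).symm

theorem Via.congr {A B : Set (ℤ × ℤ)} {s t u v s' t' u' v' : ℤ × ℤ} (h : Via A s t u v)
    (hs : s = s' := by first | rfl | (simp only [Prod.mk.injEq, true_and, and_true]; omega))
    (ht : t = t' := by first | rfl | (simp only [Prod.mk.injEq, true_and, and_true]; omega))
    (hu : u = u' := by first | rfl | (simp only [Prod.mk.injEq, true_and, and_true]; omega))
    (hv : v = v' := by first | rfl | (simp only [Prod.mk.injEq, true_and, and_true]; omega))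
    (hAB : ∀ x y, (x, y) ∈ A ↔ (x, y) ∈ B := by
      intro x y
      first
        | exact Iff.rfl
        | simp only [Set.mem_union, Set.mem_sdiff, Set.mem_singleton_iff, Prod.mk.injEq, mem_box,
            mem_ell]
          omega) :
    Via B s' t' u' v' := by
  subst hs ht hu hv
  rwa [show B = A from Set.ext fun x => (hAB x.1 x.2).symm]

theorem Via.map {A : Set (ℤ × ℤ)} {s t u v : ℤ × ℤ} (f g : ℤ × ℤ → ℤ × ℤ)
    (hgf : ∀ x, g (f x) = x) (hfg : ∀ x, f (g x) = x)
    (hf : ∀ x y, supergrid.Adj x y → supergrid.Adj (f x) (f y)) (h : Via A s t u v) :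
    Via (g ⁻¹' A) (f s) (f t) (f u) (f v) := by
  obtain ⟨huv, C, D, hCD, rfl, h⟩ := h
  refine ⟨hf _ _ huv, g ⁻¹' C, g ⁻¹' D, fun x => hCD (g x), rfl, h.imp ?_ ?_⟩
  all_goals exact fun h => ⟨h.1.map f g hgf hfg hf, h.2.map f g hgf hfg hf⟩

/-- The edge `uv` of a traversal is replaced by a detour through a disjoint set, which again uses a
prescribed edge. -/
theorem Via.insertVia {A B : Set (ℤ × ℤ)} {s t u v p q e f : ℤ × ℤ} (hA : Via A s t u v)
    (hB : Via B p q e f)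
    (hup : supergrid.Adj u p := by simp only [supergrid_adj]; omega)
    (hqv : supergrid.Adj q v := by simp only [supergrid_adj]; omega)
    (hAB : ∀ x y, (x, y) ∈ A → (x, y) ∈ B → False := by
      intro x y
      simp only [Set.mem_union, Set.mem_sdiff, Set.mem_singleton_iff, Prod.mk.injEq, mem_box]
      omega) :
    Via (A ∪ B) s t e f := by
  obtain ⟨-, C, D, hCD, rfl, h⟩ := hA
  have hCB : ∀ x y, (x, y) ∈ C → (x, y) ∈ B → False := fun x y h => hAB x y (Or.inl h)
  have hCBD : ∀ x y, (x, y) ∈ C ∪ B → (x, y) ∈ D → False := fun x y h h' =>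
    h.elim (fun h => hCD _ h h') (fun h => hAB x y (Or.inr h') h)
  rw [Set.union_right_comm]
  rcases h with ⟨h₁, h₂⟩ | ⟨h₁, h₂⟩
  · exact (h₁.appendVia hB hup hCB).append h₂ hqv hCBD
  · exact (h₁.appendVia hB.symm hqv.symm hCB).append h₂ hup.symm hCBD

theorem Via.insert {A B : Set (ℤ × ℤ)} {s t u v p q : ℤ × ℤ} (hA : Via A s t u v)
    (hB : Traverses B p q)
    (hup : supergrid.Adj u p := by simp only [supergrid_adj]; omega)
    (hqv : supergrid.Adj q v := by simp only [supergrid_adj]; omega)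
    (hAB : ∀ x y, (x, y) ∈ A → (x, y) ∈ B → False := by
      intro x y
      simp only [Set.mem_union, Set.mem_sdiff, Set.mem_singleton_iff, Prod.mk.injEq, mem_box]
      omega) :
    Traverses (A ∪ B) s t := by
  obtain ⟨-, C, D, hCD, rfl, h⟩ := hA
  have hCB : ∀ x y, (x, y) ∈ C → (x, y) ∈ B → False := fun x y h => hAB x y (Or.inl h)
  have hCBD : ∀ x y, (x, y) ∈ C ∪ B → (x, y) ∈ D → False := fun x y h h' =>
    h.elim (fun h => hCD _ h h') (fun h => hAB x y (Or.inr h') h)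
  rw [Set.union_right_comm]
  rcases h with ⟨h₁, h₂⟩ | ⟨h₁, h₂⟩
  · exact (h₁.append hB hup hCB).append h₂ hqv hCBD
  · exact (h₁.append hB.symm hqv.symm hCB).append h₂ hup.symm hCBD

/-! ### Rows, columns and strips of two rows -/

theorem traverses_point (x y : ℤ) : Traverses (box x x y y) (x, y) (x, y) :=
  (Traverses.single (x, y)).congr

theorem traverses_row {a b : ℤ} (c : ℤ) (hab : a ≤ b) :
    Traverses (box a b c c) (a, c) (b, c) := by
  induction b, hab using Int.leInduction with
  | base => exact traverses_point a c
  | succ b hab ih => exact (ih.append (traverses_point (b + 1) c)).congr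

theorem traverses_col {c d : ℤ} (a : ℤ) (hcd : c ≤ d) :
    Traverses (box a a c d) (a, c) (a, d) := by
  induction d, hcd using Int.leInduction with
  | base => exact traverses_point a c
  | succ d hcd ih => exact (ih.append (traverses_point a (d + 1))).congr

/-- A strip of two rows is traversed from one point of its last column to the other one. -/
theorem uturn_left_via_end {a b c q v : ℤ} (hab : a ≤ b) (hq : c ≤ q ∧ q ≤ c + 1)
    (hv : c ≤ v ∧ v ≤ c + 1) (hqv : q ≠ v) :
    Via (box a b c (c + 1)) (b, q) (b, v) (a, c) (a, c + 1) := by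
  have h : Via (box a b c (c + 1)) (b, c) (b, c + 1) (a, c) (a, c + 1) :=
    ((traverses_row c hab).symm.via (traverses_row (c + 1) hab)).congr
  obtain ⟨rfl, rfl⟩ | ⟨rfl, rfl⟩ : (q = c ∧ v = c + 1) ∨ (q = c + 1 ∧ v = c) := by omega
  exacts [h, h.symm]

theorem uturn_left_via_corner {a b c q v : ℤ} (hab : a < b) (hq : c ≤ q ∧ q ≤ c + 1)
    (hv : c ≤ v ∧ v ≤ c + 1) (hqv : q ≠ v) :
    Via (box a b c (c + 1)) (b, q) (b, v) (a, c) (a + 1, c) := by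
  have h : Via (box a b c (c + 1)) (b, c) (b, c + 1) (a + 1, c) (a, c) :=
    ((traverses_row c (show a + 1 ≤ b by omega)).symm.via
      ((traverses_point a c).append (traverses_row (c + 1) hab.le))).congr
  obtain ⟨rfl, rfl⟩ | ⟨rfl, rfl⟩ : (q = c ∧ v = c + 1) ∨ (q = c + 1 ∧ v = c) := by omega
  exacts [h.swap, h.symm.swap]

theorem uturn_right_via_corner {a b c q v : ℤ} (hab : a < b) (hq : c ≤ q ∧ q ≤ c + 1)
    (hv : c ≤ v ∧ v ≤ c + 1) (hqv : q ≠ v) :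
    Via (box a b c (c + 1)) (a, q) (a, v) (a, c) (a + 1, c) := by
  have h : Via (box a b c (c + 1)) (a, c) (a, c + 1) (a, c) (a + 1, c) :=
    ((traverses_point a c).via ((traverses_row c (show a + 1 ≤ b by omega)).append
      (traverses_row (c + 1) hab.le).symm)).congr
  obtain ⟨rfl, rfl⟩ | ⟨rfl, rfl⟩ : (q = c ∧ v = c + 1) ∨ (q = c + 1 ∧ v = c) := by omega
  exacts [h, h.symm]

theorem uturn_right {a b c q v : ℤ} (hab : a ≤ b) (hq : c ≤ q ∧ q ≤ c + 1)
    (hv : c ≤ v ∧ v ≤ c + 1) (hqv : q ≠ v) :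
    Traverses (box a b c (c + 1)) (a, q) (a, v) := by
  have h : Traverses (box a b c (c + 1)) (a, c) (a, c + 1) :=
    ((traverses_row c hab).append (traverses_row (c + 1) hab).symm).congr
  obtain ⟨rfl, rfl⟩ | ⟨rfl, rfl⟩ : (q = c ∧ v = c + 1) ∨ (q = c + 1 ∧ v = c) := by omega
  exacts [h, h.symm]

/-- Going through a strip of two rows column by column. -/
theorem zigzag {a b : ℤ} (c : ℤ) (hab : a ≤ b) :
    Traverses (box a b c (c + 1)) (a, c) (b, c + 1) := by
  have hcol (x : ℤ) : Traverses (box x x c (c + 1)) (x, c) (x, c + 1) :=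
    traverses_col x (by omega)
  induction b, hab using Int.leInduction with
  | base => exact hcol a
  | succ b hab ih => exact (ih.append (hcol (b + 1))).congr

/-- In a strip of two rows, a traversal between different columns can use both points of the first
column consecutively. -/
theorem strip_via_end {a b c p q u v : ℤ} (hap : a ≤ p) (hpu : p < u) (hub : u ≤ b)
    (hq : c ≤ q ∧ q ≤ c + 1) (hv : c ≤ v ∧ v ≤ c + 1) :
    Via (box a b c (c + 1)) (p, q) (u, v) (a, c) (a, c + 1) := by
  have hl : Via (box a p c (c + 1)) (p, q) (p, 2 * c + 1 - q) (a, c) (a, c + 1) :=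
    uturn_left_via_end hap hq (by omega) (by omega)
  have hr : Traverses (box u b c (c + 1)) (u, 2 * c + 1 - v) (u, v) :=
    uturn_right hub (by omega) hv (by omega)
  obtain rfl | hlt : u = p + 1 ∨ p + 1 < u := by omega
  · exact (hl.append hr).congr
  · exact ((hl.append (zigzag c (show p + 1 ≤ u - 1 by omega))).append hr).congr

theorem strip_traverses {a b c p q u v : ℤ} (hap : a ≤ p) (hpu : p < u) (hub : u ≤ b)
    (hq : c ≤ q ∧ q ≤ c + 1) (hv : c ≤ v ∧ v ≤ c + 1) :
    Traverses (box a b c (c + 1)) (p, q) (u, v) :=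
  (strip_via_end hap hpu hub hq hv).traverses

theorem strip_via_corner_of_lt {a b c p q u v : ℤ} (hap : a ≤ p) (hpu : p < u) (hub : u ≤ b)
    (hq : c ≤ q ∧ q ≤ c + 1) (hv : c ≤ v ∧ v ≤ c + 1)
    (hb : u ≤ a + 1 → q = c + 1 ∧ v = c + 1) :
    Via (box a b c (c + 1)) (p, q) (u, v) (a, c) (a + 1, c) := by
  have hr : Traverses (box u b c (c + 1)) (u, 2 * c + 1 - v) (u, v) :=
    uturn_right hub (by omega) hv (by omega)
  obtain hlt | rfl := hap.lt_or_eq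
  · have hl : Via (box a p c (c + 1)) (p, q) (p, 2 * c + 1 - q) (a, c) (a + 1, c) :=
      uturn_left_via_corner hlt hq (by omega) (by omega)
    obtain rfl | hlt : u = p + 1 ∨ p + 1 < u := by omega
    · exact (hl.append hr).congr
    · exact ((hl.append (zigzag c (show p + 1 ≤ u - 1 by omega))).append hr).congr
  obtain rfl | hlt : u = a + 1 ∨ a + 1 < u := by omega
  · obtain ⟨rfl, rfl⟩ := hb le_rfl
    have hr' : Traverses (box (a + 1) b c (c + 1)) (a + 1, c) (a + 1, c + 1) := hr.congr
    exact (((traverses_point a (c + 1)).append (traverses_point a c)).via hr').congr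
  · have hl : Via (box a (a + 1) c (c + 1)) (a, q) (a + 1, c + 1) (a, c) (a + 1, c) := by
      obtain rfl | rfl : q = c ∨ q = c + 1 := by omega
      · exact ((traverses_point a q).via ((traverses_point (a + 1) q).append
          ((traverses_point a (q + 1)).append (traverses_point (a + 1) (q + 1))))).congr
      · exact (((traverses_point a (c + 1)).append (traverses_point a c)).via
          ((traverses_point (a + 1) c).append (traverses_point (a + 1) (c + 1)))).congr
    obtain rfl | hlt : u = a + 2 ∨ a + 2 < u := by omega
    · exact (hl.append hr).congr
    · exact ((hl.append (zigzag c (show a + 2 ≤ u - 1 by omega))).append hr).congr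

theorem strip_via_corner {a b c p q u v : ℤ} (hab : a < b) (hp : a ≤ p ∧ p ≤ b)
    (hu : a ≤ u ∧ u ≤ b) (hq : c ≤ q ∧ q ≤ c + 1) (hv : c ≤ v ∧ v ≤ c + 1)
    (hne : p = u → q ≠ v ∧ (p = a ∨ p = b))
    (hb : p ≤ a + 1 → u ≤ a + 1 → p ≠ u → q = c + 1 ∧ v = c + 1) :
    Via (box a b c (c + 1)) (p, q) (u, v) (a, c) (a + 1, c) := by
  rcases lt_trichotomy p u with h | rfl | h
  · exact strip_via_corner_of_lt hp.1 h hu.2 hq hv fun h' => hb (by omega) h' h.ne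
  · obtain ⟨hqv, rfl | rfl⟩ := hne rfl
    exacts [uturn_right_via_corner hab hq hv hqv, uturn_left_via_corner hab hq hv hqv]
  · exact (strip_via_corner_of_lt hu.1 h hp.2 hv hq
      fun h' => (hb h' (by omega) h.ne').symm).symm

/-! ### Reflections of rectangles -/

theorem Via.mirror {a b c d p q u v e f g k : ℤ}
    (h : Via (box a b c d) (p, q) (u, v) (e, f) (g, k)) :
    Via (box a b c d) (a + b - p, q) (a + b - u, v) (a + b - e, f) (a + b - g, k) := by
  have hinv : ∀ x : ℤ × ℤ, (a + b - (a + b - x.1), x.2) = x := fun x => by simp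
  refine (h.map (fun x => (a + b - x.1, x.2)) (fun x => (a + b - x.1, x.2)) hinv hinv
    ?_).congr rfl rfl rfl rfl ?_
  · rintro ⟨x, y⟩ ⟨x', y'⟩
    simp only [supergrid_adj]
    omega
  · intro x y
    simp only [Set.mem_preimage, mem_box]
    omega

theorem supergrid_adj_swap (x y : ℤ × ℤ) (h : supergrid.Adj x y) :
    supergrid.Adj x.swap y.swap := by
  obtain ⟨x, x'⟩ := x
  obtain ⟨y, y'⟩ := y
  simp only [Prod.swap_prod_mk, supergrid_adj] at h ⊢
  omega

theorem Traverses.transpose {a b c d p q u v : ℤ}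
    (h : Traverses (box a b c d) (p, q) (u, v)) :
    Traverses (box c d a b) (q, p) (v, u) := by
  refine (h.map Prod.swap Prod.swap Prod.swap_swap Prod.swap_swap supergrid_adj_swap).congr
    rfl rfl ?_
  intro x y
  simp only [Set.mem_preimage, Prod.swap_prod_mk, mem_box]
  omega

theorem Via.transpose {a b c d p q u v e f g k : ℤ}
    (h : Via (box a b c d) (p, q) (u, v) (e, f) (g, k)) :
    Via (box c d a b) (q, p) (v, u) (f, e) (k, g) := by
  refine (h.map Prod.swap Prod.swap Prod.swap_swap Prod.swap_swap supergrid_adj_swap).congr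
    rfl rfl rfl rfl ?_
  intro x y
  simp only [Set.mem_preimage, Prod.swap_prod_mk, mem_box]
  omega

/-! ### Rectangles -/

/-- The points `(p, q)` and `(u, v)` are distinct points of the rectangle `box a b c d` and do not
separate it: they do not form an inner row or an inner column of a rectangle of width two. -/
structure Linkable (a b c d p q u v : ℤ) : Prop where
  left_le : a ≤ p ∧ a ≤ u
  le_right : p ≤ b ∧ u ≤ b
  top_le : c ≤ q ∧ c ≤ v
  le_bottom : q ≤ d ∧ v ≤ d
  ne : p ≠ u ∨ q ≠ v
  col : d = c + 1 → p = u → p = a ∨ p = b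
  row : b = a + 1 → q = v → q = c ∨ q = d

/-- Any two linkable points of the rectangle are the ends of a traversal. -/
def RectLinked (a b c d : ℤ) : Prop :=
  ∀ p q u v, Linkable a b c d p q u v → Traverses (box a b c d) (p, q) (u, v)

/-- Any two linkable points of the rectangle are the ends of a traversal through the edge from
`(a, c)` to `(a + 1, c)`, except for the pairs for which this is impossible: the ends of this edge,
and, in a rectangle of two rows, the two diagonals of its first two columns. -/
def CornerLinked (a b c d : ℤ) : Prop :=
  ∀ p q u v, Linkable a b c d p q u v → (p ≤ a + 1 → u ≤ a + 1 → q = c → v ≠ c) →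
    (d = c + 1 → p ≤ a + 1 → u ≤ a + 1 → p ≠ u → q = d ∧ v = d) →
    Via (box a b c d) (p, q) (u, v) (a, c) (a + 1, c)

theorem Linkable.symm {a b c d p q u v : ℤ} (h : Linkable a b c d p q u v) :
    Linkable a b c d u v p q := by
  obtain ⟨h₁, h₂, h₃, h₄, h₅, h₆, h₇⟩ := h
  constructor <;> omega

/-- At least one of the two upper corners of a rectangle of width at least three is not affected by
the exceptions in `CornerLinked`. -/
theorem CornerLinked.exists_top_edge {a b c d p q u v : ℤ} (h : CornerLinked a b c d)
    (hab : a + 2 ≤ b) (hl : Linkable a b c d p q u v) :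
    ∃ x, a ≤ x ∧ x + 1 ≤ b ∧ Via (box a b c d) (p, q) (u, v) (x, c) (x + 1, c) := by
  obtain ⟨h₁, h₂, h₃, h₄, h₅, h₆, h₇⟩ := hl
  by_cases hc : p ≤ a + 1 ∧ u ≤ a + 1 ∧ p ≠ u
  · have := (h (a + b - p) q (a + b - u) v (by constructor <;> omega) (by omega)
      (by omega)).mirror
    exact ⟨b - 1, by omega, by omega, this.swap.congr⟩
  · exact ⟨a, le_rfl, by omega, h p q u v ⟨h₁, h₂, h₃, h₄, h₅, h₆, h₇⟩ (by omega) (by omega)⟩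

theorem rectLinked_of_width_two {a b c d : ℤ} (hb : b = a + 1) (hcd : c < d) :
    RectLinked a b c d := by
  rintro p q u v ⟨h₁, h₂, h₃, h₄, h₅, h₆, h₇⟩
  subst hb
  rcases lt_trichotomy q v with h | rfl | h
  · exact (strip_traverses (by omega) h (by omega) (by omega) (by omega)).transpose
  · rcases h₇ rfl rfl with rfl | rfl
    · exact (uturn_right hcd.le (by omega) (by omega) (by omega)).transpose
    · exact (uturn_left_via_end hcd.le (by omega) (by omega) (by omega)).transpose.traverses
  · exact (strip_traverses (by omega) h (by omega) (by omega) (by omega)).symm.transpose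

theorem cornerLinked_of_width_two {a b c d : ℤ} (hb : b = a + 1) (hcd : c + 1 < d) :
    CornerLinked a b c d := by
  rintro p q u v ⟨h₁, h₂, h₃, h₄, h₅, h₆, h₇⟩ he -
  subst hb
  rcases lt_trichotomy q v with h | rfl | h
  · exact (strip_via_end (by omega) h (by omega) (by omega) (by omega)).transpose
  · obtain rfl : q = d := by omega
    exact (uturn_left_via_end (by omega) (by omega) (by omega) (by omega)).transpose
  · exact (strip_via_end (by omega) h (by omega) (by omega) (by omega)).symm.transpose

theorem cornerLinked_of_height_two {a b c d : ℤ} (hab : a < b) (hd : d = c + 1) :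
    CornerLinked a b c d := by
  rintro p q u v ⟨h₁, h₂, h₃, h₄, h₅, h₆, h₇⟩ he hx
  subst hd
  exact strip_via_corner hab (by omega) (by omega) (by omega) (by omega) (by omega) (by omega)

theorem CornerLinked.rectLinked {a b c d : ℤ} (h : CornerLinked a b c d) (hab : a < b)
    (hcd : c < d) : RectLinked a b c d := by
  obtain hb | hb : b = a + 1 ∨ a + 2 ≤ b := by omega
  · exact rectLinked_of_width_two hb hcd
  · intro p q u v hl
    obtain ⟨x, -, -, hx⟩ := h.exists_top_edge hb hl
    exact hx.traverses

/-- The neighbours of a corner of a rectangle form a clique, so the corner can be left out. -/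
theorem RectLinked.cornerless {a b c d p q u v : ℤ} (h : RectLinked a b c d)
    (hl : Linkable a b c d p q u v) (hs : a < p ∨ c < q) (ht : a < u ∨ c < v) :
    Traverses (box a b c d \ {(a, c)}) (p, q) (u, v) := by
  have hl' := hl
  obtain ⟨h₁, h₂, h₃, h₄, h₅, h₆, h₇⟩ := hl'
  refine (h p q u v hl).delete ?_ ?_ ?_ ?_
  · rw [mem_box]
    omega
  · simp only [ne_eq, Prod.mk.injEq]
    omega
  · simp only [ne_eq, Prod.mk.injEq]
    omega
  · rintro ⟨x, y⟩ hx ⟨x', y'⟩ hx'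
    simp only [mem_box, supergrid_adj, ne_eq, Prod.mk.injEq] at hx hx' ⊢
    omega

/-- The case of `CornerLinked` where the traversal starts at an end of the edge. -/
theorem via_corner_of_start {a b c d p q u v : ℤ} (hab : a + 2 ≤ b) (hcd : c + 2 ≤ d)
    (hr : RectLinked a b (c + 1) d) (hc : RectLinked (a + 1) b c d) (hp : a ≤ p ∧ p ≤ a + 1)
    (hq : q = c) (hu : a ≤ u ∧ u ≤ b) (hv : c ≤ v ∧ v ≤ d) (hut : a + 2 ≤ u ∨ c + 1 ≤ v) :
    Via (box a b c d) (p, q) (u, v) (a, c) (a + 1, c) := by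
  subst hq
  have hs := traverses_point p q
  obtain rfl | rfl : p = a ∨ p = a + 1 := by omega
  · -- the first row is run through from left to right, with a break just before `t` if `t` is on it
    obtain hv | rfl : q + 1 ≤ v ∨ v = q := by omega
    · have hrow := traverses_row q (show p + 1 ≤ b by omega)
      by_cases ht : u = b ∧ v = q + 1
      · exact (hs.via (hrow.append (hr (b - 1) (q + 1) u v (by constructor <;> omega)))).congr
      · exact (hs.via (hrow.append (hr b (q + 1) u v (by constructor <;> omega)))).congr
    · exact (hs.via ((traverses_row v (show p + 1 ≤ u - 1 by omega)).append
        ((hr (u - 1) (v + 1) b (v + 1) (by constructor <;> omega)).append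
          (traverses_row v hu.2).symm))).congr
  · -- now the same with the first column instead of the first row
    obtain hu | rfl : a + 1 ≤ u ∨ u = a := by omega
    · have hcol := traverses_col a (show q ≤ d by omega)
      by_cases ht : u = a + 1 ∧ v = d
      · exact (hs.via (hcol.append (hc.cornerless (p := a + 1) (q := d - 1) (u := u) (v := v)
          (by constructor <;> omega) (by omega) (by omega)))).swap.congr
      · exact (hs.via (hcol.append (hc.cornerless (p := a + 1) (q := d) (u := u) (v := v)
          (by constructor <;> omega) (by omega) (by omega)))).swap.congr
    · have hcol := (traverses_col u hv.2).symm
      obtain rfl | hv' : v = q + 1 ∨ q + 2 ≤ v := by omega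
      · exact (hs.via ((traverses_point u q).append ((hc.cornerless (p := u + 1) (q := q + 1)
          (u := u + 1) (v := d) (by constructor <;> omega) (by omega) (by omega)).append
            hcol))).swap.congr
      · exact (hs.via ((traverses_col u (show q ≤ v - 1 by omega)).append ((hc.cornerless
          (p := u + 1) (q := v - 1) (u := u + 1) (v := d) (by constructor <;> omega) (by omega)
            (by omega)).append hcol))).swap.congr

/-- Two columns `x` and `y`, equal or next to each other, that avoid one given column each. A path
can pass from one rectangle to the rectangle below it in these columns: with `p` the column of the
start and `u` the column of the end, no pair to be linked lies in a common column. -/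
theorem exists_near_avoiding {a b : ℤ} (hab : a < b) (p u : ℤ) :
    ∃ x y, (a ≤ x ∧ x ≤ b) ∧ (a ≤ y ∧ y ≤ b) ∧ x ≠ p ∧ y ≠ u ∧ x - y ≤ 1 ∧ y - x ≤ 1 := by
  obtain ⟨x, hx, hxp⟩ : ∃ x, (a ≤ x ∧ x ≤ b) ∧ x ≠ p := by
    by_cases h : p = a
    exacts [⟨b, by omega, by omega⟩, ⟨a, by omega, by omega⟩]
  by_cases h : x = u
  · by_cases hxb : x = b
    exacts [⟨x, x - 1, by omega⟩, ⟨x, x + 1, by omega⟩]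
  · exact ⟨x, x, by omega⟩

/-- The first two rows of a rectangle are cut off, and the rest is dealt with by `CornerLinked`,
which provides an edge where a detour through these rows can be inserted. The two rows contribute
the prescribed edge `ef`, and they do not contain both ends. The predicate `K` describes the points
from which a traversal of these rows through `ef` to any point of their second row in another
column is available. -/
theorem via_of_top_strip {a b c d p q u v : ℤ} {e f : ℤ × ℤ} (K : ℤ → ℤ → Prop)
    (hab : a + 2 ≤ b) (hcd : c + 3 ≤ d) (hK : ∀ x, a ≤ x → x ≤ b → K x (c + 1))
    (hstrip : ∀ x y z, a ≤ x ∧ x ≤ b → c ≤ y ∧ y ≤ c + 1 → a ≤ z ∧ z ≤ b → x ≠ z → K x y →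
      Via (box a b c (c + 1)) (x, y) (z, c + 1) e f)
    (hbot : CornerLinked a b (c + 2) d) (hl : Linkable a b c d p q u v)
    (hs : q ≤ c + 1 → K p q) (ht : v ≤ c + 1 → K u v) (hqv : ¬(q ≤ c + 1 ∧ v ≤ c + 1)) :
    Via (box a b c d) (p, q) (u, v) e f := by
  have hrect := hbot.rectLinked (by omega) (by omega)
  -- one end in the strip, the other one below it
  have cross : ∀ p q u v, Linkable a b c d p q u v → (q ≤ c + 1 → K p q) → q ≤ c + 1 →
      c + 2 ≤ v → Via (box a b c d) (p, q) (u, v) e f := by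
    rintro p q u v ⟨h₁, h₂, h₃, h₄, h₅, h₆, h₇⟩ hs hq hv
    obtain ⟨x, y, hx, hy, hxp, hyu, hxy⟩ := exists_near_avoiding (show a < b by omega) p u
    exact ((hstrip p q x (by omega) (by omega) hx hxp.symm (hs hq)).append
      (hrect y (c + 2) u v (by constructor <;> omega))).congr
  -- a column of two rows below the strip, which has to be left on both sides
  have column : d = c + 3 → a < p → p < b →
      Via (box a b c d) (p, c + 2) (p, c + 3) e f := by
    rintro rfl hpa hpb
    have hleft : Traverses (box a (p - 1) (c + 2) (c + 3)) (p - 1, c + 3) (p - 1, c + 2) :=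
      (uturn_left_via_end (a := a) (b := p - 1) (c := c + 2) (q := c + 3) (v := c + 2) (by omega)
        (by omega) (by omega) (by omega)).traverses.congr
    have hright : Traverses (box (p + 1) b (c + 2) (c + 3)) (p + 1, c + 2) (p + 1, c + 3) :=
      (uturn_right (a := p + 1) (b := b) (c := c + 2) (q := c + 2) (v := c + 3) (by omega)
        (by omega) (by omega) (by omega)).congr
    have htop := hstrip p (c + 1) (p + 1) (by omega) (by omega) (by omega) (by omega)
      (hK p (by omega) (by omega))
    exact (((traverses_point p (c + 2)).append hleft).appendVia
      (htop.append (hright.append (traverses_point p (c + 3))))).congr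
  have hl' := hl
  obtain ⟨h₁, h₂, h₃, h₄, h₅, h₆, h₇⟩ := hl'
  by_cases hq : q ≤ c + 1
  · exact cross p q u v hl hs hq (by omega)
  by_cases hv : v ≤ c + 1
  · exact (cross u v p q hl.symm ht hv (by omega)).symm
  by_cases hbad : d = c + 3 ∧ p = u ∧ a < p ∧ p < b
  · obtain ⟨rfl, rfl, hpa, hpb⟩ := hbad
    obtain ⟨rfl, rfl⟩ | ⟨rfl, rfl⟩ : (q = c + 2 ∧ v = c + 3) ∨ (q = c + 3 ∧ v = c + 2) := by
      omega
    exacts [column rfl hpa hpb, (column rfl hpa hpb).symm]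
  · obtain ⟨x, hxa, hxb, hx⟩ := hbot.exists_top_edge (p := p) (q := q) (u := u) (v := v) hab
      (by constructor <;> omega)
    exact (hx.insertVia (hstrip x (c + 1) (x + 1) (by omega) (by omega) (by omega) (by omega)
      (hK x hxa (by omega)))).congr

/-- The case of `CornerLinked` where the ends are the two points below the edge: the path runs up
to the first row, along this row, and back through the other rows. -/
theorem via_corner_below {a b c d : ℤ} (hab : a + 2 ≤ b) (hcd : c + 2 ≤ d)
    (hr : RectLinked a b (c + 1) d) :
    Via (box a b c d) (a, c + 1) (a + 1, c + 1) (a, c) (a + 1, c) :=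
  (((traverses_point a (c + 1)).append (traverses_point a c)).via
    ((traverses_row c (show a + 1 ≤ b by omega)).append
      (hr.cornerless (p := b) (q := c + 1) (u := a + 1) (v := c + 1) (by constructor <;> omega)
        (by omega) (by omega)))).congr

/-- The case of `CornerLinked` for rectangles of width three, with both ends in the first two rows.
The ends are ordered row by row. -/
theorem via_corner_of_width_three {a c d p q u v : ℤ} (hcd : c + 2 ≤ d)
    (hr : c + 3 ≤ d → RectLinked a (a + 2) (c + 2) d)
    (hp : a ≤ p ∧ p ≤ a + 2) (hu : a ≤ u ∧ u ≤ a + 2) (hq : c ≤ q ∧ q ≤ c + 1)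
    (hv : c ≤ v ∧ v ≤ c + 1) (hs : q = c → p = a + 2) (ht : v = c → u = a + 2)
    (hne : a + 2 ≤ p ∨ a + 2 ≤ u) (hlt : p + 3 * q < u + 3 * v) :
    Via (box a (a + 2) c d) (p, q) (u, v) (a, c) (a + 1, c) := by
  have P := traverses_point
  have B : Traverses (box a (a + 2) (c + 2) d) (a, c + 2) (a + 2, c + 2) := by
    obtain rfl | h : d = c + 2 ∨ c + 3 ≤ d := by omega
    · exact traverses_row _ (by omega)
    · exact hr h _ _ _ _ (by constructor <;> omega)
  have hv' : v = c + 1 := by omega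
  have hpu : p = a + 2 ∧ q = c ∨ u = a + 2 ∧ q = c + 1 := by omega
  obtain ⟨rfl, rfl, rfl, rfl⟩ | ⟨rfl, rfl, rfl, rfl⟩ | ⟨rfl, rfl, rfl, rfl⟩ |
      ⟨rfl, rfl, rfl, rfl⟩ | ⟨rfl, rfl, rfl, rfl⟩ :
      (p = a + 2 ∧ q = c ∧ u = a ∧ v = c + 1) ∨ (p = a + 2 ∧ q = c ∧ u = a + 1 ∧ v = c + 1) ∨
      (p = a + 2 ∧ q = c ∧ u = a + 2 ∧ v = c + 1) ∨
      (p = a ∧ q = c + 1 ∧ u = a + 2 ∧ v = c + 1) ∨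
      (p = a + 1 ∧ q = c + 1 ∧ u = a + 2 ∧ v = c + 1) := by omega
  · exact (((P (u + 2) q).append (P (u + 1) q)).via ((P u q).append ((P (u + 1) (q + 1)).append
      ((P (u + 2) (q + 1)).append (B.symm.append (P u (q + 1))))))).swap.congr
  · exact (((P (a + 2) q).append (P (a + 1) q)).via ((P a q).append ((P a (q + 1)).append
      (B.append ((P (a + 2) (q + 1)).append (P (a + 1) (q + 1))))))).swap.congr
  · exact (((P (a + 2) q).append (P (a + 1) q)).via ((P a q).append ((P a (q + 1)).append
      ((P (a + 1) (q + 1)).append (B.append (P (a + 2) (q + 1))))))).swap.congr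
  · exact (((P p (c + 1)).append (P p c)).via ((P (p + 1) c).append ((P (p + 2) c).append
      ((P (p + 1) (c + 1)).append (B.append (P (p + 2) (c + 1))))))).congr
  · exact (((P (a + 1) (c + 1)).append (B.symm.append ((P a (c + 1)).append (P a c)))).via
      ((P (a + 1) c).append ((P (a + 2) c).append (P (a + 2) (c + 1))))).congr

/-- The case of `CornerLinked` for rectangles of height three, with both ends in the first two
columns. -/
theorem via_corner_of_height_three {a b c p q u v : ℤ} (hab : a + 2 ≤ b)
    (hr : a + 3 ≤ b → RectLinked (a + 2) b c (c + 2))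
    (hp : a ≤ p ∧ p ≤ a + 1) (hu : a ≤ u ∧ u ≤ a + 1) (hq : c + 1 ≤ q ∧ q ≤ c + 2)
    (hv : c + 1 ≤ v ∧ v ≤ c + 2) (hne : c + 2 ≤ q ∨ c + 2 ≤ v) (hlt : p + 3 * q < u + 3 * v) :
    Via (box a b c (c + 2)) (p, q) (u, v) (a, c) (a + 1, c) := by
  have P := traverses_point
  have R : Traverses (box (a + 2) b c (c + 2)) (a + 2, c) (a + 2, c + 2) := by
    obtain rfl | h : b = a + 2 ∨ a + 3 ≤ b := by omega
    · exact traverses_col _ (by omega)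
    · exact hr h _ _ _ _ (by constructor <;> omega)
  have hv' : v = c + 2 := by omega
  obtain ⟨rfl, rfl, rfl, rfl⟩ | ⟨rfl, rfl, rfl, rfl⟩ | ⟨rfl, rfl, rfl, rfl⟩ |
      ⟨rfl, rfl, rfl, rfl⟩ | ⟨rfl, rfl, rfl, rfl⟩ :
      (p = a ∧ q = c + 1 ∧ u = a ∧ v = c + 2) ∨ (p = a ∧ q = c + 1 ∧ u = a + 1 ∧ v = c + 2) ∨
      (p = a + 1 ∧ q = c + 1 ∧ u = a ∧ v = c + 2) ∨
      (p = a + 1 ∧ q = c + 1 ∧ u = a + 1 ∧ v = c + 2) ∨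
      (p = a ∧ q = c + 2 ∧ u = a + 1 ∧ v = c + 2) := by omega
  · exact (((P u (c + 1)).append (P u c)).via ((P (u + 1) c).append (R.append
      ((P (u + 1) (c + 1)).append ((P (u + 1) (c + 2)).append (P u (c + 2))))))).congr
  · exact (((P p (c + 1)).append (P p c)).via ((P (p + 1) c).append (R.append
      ((P (p + 1) (c + 1)).append ((P p (c + 2)).append (P (p + 1) (c + 2))))))).congr
  · exact (((P u (c + 2)).append ((P u (c + 1)).append (P u c))).via ((P (u + 1) c).append
      (R.append ((P (u + 1) (c + 2)).append (P (u + 1) (c + 1)))))).symm.congr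
  · exact (((P (a + 1) (c + 1)).append ((P a (c + 2)).append ((P a (c + 1)).append (P a c)))).via
      ((P (a + 1) c).append (R.append (P (a + 1) (c + 2))))).congr
  · exact (((P p (c + 2)).append ((P p (c + 1)).append (P p c))).via ((P (p + 1) c).append
      (R.append ((P (p + 1) (c + 1)).append (P (p + 1) (c + 2)))))).congr

/-- The case of `CornerLinked` for the three by three square, with one end in the last row and
one end in the last column. -/
theorem via_corner_of_three_by_three {a c p q u v : ℤ}
    (hp : a ≤ p ∧ p ≤ a + 2) (hu : a ≤ u ∧ u ≤ a + 2) (hq : c ≤ q ∧ q ≤ c + 2)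
    (hv : c ≤ v ∧ v ≤ c + 2) (hs : q = c → p = a + 2) (ht : v = c → u = a + 2)
    (hne : a + 2 ≤ p ∨ a + 2 ≤ u) (hne' : c + 2 ≤ q ∨ c + 2 ≤ v)
    (hlt : p + 3 * q < u + 3 * v) :
    Via (box a (a + 2) c (c + 2)) (p, q) (u, v) (a, c) (a + 1, c) := by
  have P := traverses_point
  obtain rfl : v = c + 2 := by omega
  obtain rfl | rfl | rfl : u = a ∨ u = a + 1 ∨ u = a + 2 := by omega
  · obtain ⟨rfl, rfl⟩ | ⟨rfl, rfl⟩ : (p = u + 2 ∧ q = c) ∨ (p = u + 2 ∧ q = c + 1) := by omega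
    · exact (((P (u + 2) q).append (P (u + 1) q)).via ((P u q).append ((P u (q + 1)).append
        ((P (u + 1) (q + 1)).append ((P (u + 2) (q + 1)).append ((P (u + 2) (q + 2)).append
          ((P (u + 1) (q + 2)).append (P u (q + 2))))))))).swap.congr
    · exact (((P (u + 2) (c + 1)).append ((P (u + 2) c).append (P (u + 1) c))).via
        ((P u c).append ((P u (c + 1)).append ((P (u + 1) (c + 1)).append
          ((P (u + 2) (c + 2)).append ((P (u + 1) (c + 2)).append
            (P u (c + 2)))))))).swap.congr
  · obtain ⟨rfl, rfl⟩ | ⟨rfl, rfl⟩ : (p = a + 2 ∧ q = c) ∨ (p = a + 2 ∧ q = c + 1) := by omega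
    · exact (((P (a + 2) q).append (P (a + 1) q)).via ((P a q).append ((P a (q + 1)).append
        ((P a (q + 2)).append ((P (a + 1) (q + 1)).append ((P (a + 2) (q + 1)).append
          ((P (a + 2) (q + 2)).append (P (a + 1) (q + 2))))))))).swap.congr
    · exact (((P (a + 2) (c + 1)).append ((P (a + 2) c).append (P (a + 1) c))).via
        ((P a c).append ((P a (c + 1)).append ((P a (c + 2)).append ((P (a + 1) (c + 1)).append
          ((P (a + 2) (c + 2)).append (P (a + 1) (c + 2)))))))).swap.congr
  · obtain rfl | rfl | rfl : q = c ∨ q = c + 1 ∨ q = c + 2 := by omega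
    · obtain rfl : p = a + 2 := by omega
      exact (((P (a + 2) q).append (P (a + 1) q)).via ((P a q).append ((P (a + 1) (q + 1)).append
        ((P a (q + 1)).append ((P a (q + 2)).append ((P (a + 1) (q + 2)).append
          ((P (a + 2) (q + 1)).append (P (a + 2) (q + 2))))))))).swap.congr
    · obtain rfl | rfl | rfl : p = a ∨ p = a + 1 ∨ p = a + 2 := by omega
      · exact (((P p (c + 1)).append ((P p (c + 2)).append ((P (p + 1) (c + 2)).append
          ((P (p + 1) (c + 1)).append (P p c))))).via ((P (p + 1) c).append ((P (p + 2) c).append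
            ((P (p + 2) (c + 1)).append (P (p + 2) (c + 2)))))).congr
      · exact (((P (a + 1) (c + 1)).append ((P (a + 1) (c + 2)).append ((P a (c + 2)).append
          ((P a (c + 1)).append (P a c))))).via ((P (a + 1) c).append ((P (a + 2) c).append
            ((P (a + 2) (c + 1)).append (P (a + 2) (c + 2)))))).congr
      · exact (((P (a + 2) (c + 1)).append ((P (a + 2) c).append (P (a + 1) c))).via
          ((P a c).append ((P (a + 1) (c + 1)).append ((P a (c + 1)).append ((P a (c + 2)).append
            ((P (a + 1) (c + 2)).append (P (a + 2) (c + 2)))))))).swap.congr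
    · obtain rfl | rfl : p = a ∨ p = a + 1 := by omega
      · exact (((P p (c + 2)).append ((P (p + 1) (c + 2)).append ((P (p + 1) (c + 1)).append
          ((P p (c + 1)).append (P p c))))).via ((P (p + 1) c).append ((P (p + 2) c).append
            ((P (p + 2) (c + 1)).append (P (p + 2) (c + 2)))))).congr
      · exact (((P (a + 1) (c + 2)).append ((P a (c + 2)).append ((P (a + 1) (c + 1)).append
          ((P a (c + 1)).append (P a c))))).via ((P (a + 1) c).append ((P (a + 2) c).append
            ((P (a + 2) (c + 1)).append (P (a + 2) (c + 2)))))).congr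

/-- The induction cuts off the first two rows or the first two columns. This is impossible if both
ends lie there or if only one row or column would be left, and the remaining configurations are
solved by hand. -/
theorem cornerLinked {a b c d : ℤ} (hab : a < b) (hcd : c < d) : CornerLinked a b c d := by
  obtain ⟨N, hN⟩ : ∃ N : ℕ, (b - a + (d - c)).toNat = N := ⟨_, rfl⟩
  induction N using Nat.strong_induction_on generalizing a b c d with
  | _ N ih =>
  subst hN
  have ihc : ∀ {a' b' c' d' : ℤ}, a' < b' → c' < d' → b' - a' + (d' - c') < b - a + (d - c) →
      CornerLinked a' b' c' d' := fun h₁ h₂ h₃ => ih _ (by omega) h₁ h₂ rfl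
  have ihr : ∀ {a' b' c' d' : ℤ}, a' < b' → c' < d' → b' - a' + (d' - c') < b - a + (d - c) →
      RectLinked a' b' c' d' := fun h₁ h₂ h₃ => (ihc h₁ h₂ h₃).rectLinked h₁ h₂
  obtain hd | hd : d = c + 1 ∨ c + 2 ≤ d := by omega
  · exact cornerLinked_of_height_two hab hd
  obtain hb | hb : b = a + 1 ∨ a + 2 ≤ b := by omega
  · exact cornerLinked_of_width_two hb (by omega)
  have hrow : RectLinked a b (c + 1) d := ihr hab (by omega) (by omega)
  have hcol : RectLinked (a + 1) b c d := ihr (by omega) hcd (by omega)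
  -- small configurations, where no two rows or columns can be cut off
  have small : ∀ p q u v, Linkable a b c d p q u v → (q = c → a + 2 ≤ p) → (v = c → a + 2 ≤ u) →
      (d = c + 2 ∨ q ≤ c + 1 ∧ v ≤ c + 1) → (b = a + 2 ∨ p ≤ a + 1 ∧ u ≤ a + 1) →
      p + 3 * q < u + 3 * v → Via (box a b c d) (p, q) (u, v) (a, c) (a + 1, c) := by
    rintro p q u v ⟨h₁, h₂, h₃, h₄, h₅, h₆, h₇⟩ hs ht hy hx hlt
    by_cases hx' : p ≤ a + 1 ∧ u ≤ a + 1
    · by_cases hy' : q ≤ c + 1 ∧ v ≤ c + 1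
      · obtain ⟨rfl, rfl, rfl, rfl⟩ : p = a ∧ q = c + 1 ∧ u = a + 1 ∧ v = c + 1 := by omega
        exact via_corner_below hb hd hrow
      · obtain rfl : d = c + 2 := by omega
        exact via_corner_of_height_three hb (fun h => ihr (by omega) hcd (by omega))
          (by omega) (by omega) (by omega) (by omega) (by omega) hlt
    · obtain rfl : b = a + 2 := by omega
      by_cases hy' : q ≤ c + 1 ∧ v ≤ c + 1
      · exact via_corner_of_width_three hd (fun h => ihr (by omega) (by omega) (by omega))
          (by omega) (by omega) (by omega) (by omega) (by omega) (by omega) (by omega) hlt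
      · obtain rfl : d = c + 2 := by omega
        exact via_corner_of_three_by_three (by omega) (by omega) (by omega) (by omega) (by omega)
          (by omega) (by omega) (by omega) hlt
  intro p q u v hl he _
  have hl' := hl
  obtain ⟨h₁, h₂, h₃, h₄, h₅, h₆, h₇⟩ := hl'
  by_cases hs : q = c ∧ p ≤ a + 1
  · exact via_corner_of_start hb hd hrow hcol (by omega) hs.1 (by omega) (by omega) (by omega)
  by_cases ht : v = c ∧ u ≤ a + 1
  · exact (via_corner_of_start hb hd hrow hcol (by omega) ht.1 (by omega) (by omega)
      (by omega)).symm
  by_cases hy : c + 3 ≤ d ∧ ¬(q ≤ c + 1 ∧ v ≤ c + 1)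
  · refine via_of_top_strip (fun x y => y = c → a + 2 ≤ x) hb hy.1 (by omega) ?_
      (ihc hab (by omega) (by omega)) hl (by omega) (by omega) hy.2
    intro x y z hx hy hz hxz hK
    exact strip_via_corner hab hx hz hy (by omega) (by omega) (by omega)
  by_cases hx : a + 3 ≤ b ∧ ¬(p ≤ a + 1 ∧ u ≤ a + 1)
  · refine (via_of_top_strip (a := c) (b := d) (c := a) (d := b) (p := q) (q := p) (u := v)
      (v := u) (fun _ _ => True) hd hx.1 (fun _ _ _ => trivial) ?_
      (ihc hcd (by omega) (by omega)) (by constructor <;> omega) (fun _ => trivial)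
      (fun _ => trivial) hx.2).transpose
    intro x y z hx hy hz hxz _
    rcases hxz.lt_or_gt with h | h
    · exact strip_via_end hx.1 h hz.2 hy (by omega)
    · exact (strip_via_end hz.1 h hx.2 (by omega) hy).symm
  rcases lt_trichotomy (p + 3 * q) (u + 3 * v) with h | h | h
  · exact small p q u v hl (by omega) (by omega) (by omega) (by omega) h
  · omega
  · exact (small u v p q hl.symm (by omega) (by omega) (by omega) (by omega) h).symm

theorem rectLinked {a b c d : ℤ} (hab : a < b) (hcd : c < d) : RectLinked a b c d :=
  (cornerLinked hab hcd).rectLinked hab hcd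

/-! ### Traversals of `L`-shapes -/

theorem Via.flip {a b c d p q u v e f g k : ℤ}
    (h : Via (box a b c d) (p, q) (u, v) (e, f) (g, k)) :
    Via (box a b c d) (p, c + d - q) (u, c + d - v) (e, c + d - f) (g, c + d - k) :=
  h.transpose.mirror.transpose

/-- An `L`-shape that is a rectangle without one corner: the corner is dropped from a traversal of
the rectangle. -/
theorem traverses_ell_of_corner {m n p q u v : ℤ} (hm : 1 < m) (hn : 1 < n)
    (hs : (p, q) ∈ ell m (m - 1) 1 n) (ht : (u, v) ∈ ell m (m - 1) 1 n) (hne : p ≠ u ∨ q ≠ v)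
    (hcol : n = 2 → p = u → p = 1 ∨ p = m) (hrow : m = 2 → q = v → q = 1 ∨ q = n) :
    Traverses (ell m (m - 1) 1 n) (p, q) (u, v) := by
  rw [mem_ell] at hs ht
  have h := ((rectLinked hm hn).cornerless (p := 1 + m - p) (q := q) (u := 1 + m - u) (v := v)
    (by constructor <;> omega) (by omega) (by omega))
  have hinv : ∀ x : ℤ × ℤ, (1 + m - (1 + m - x.1), x.2) = x := fun x => by simp
  refine (h.map (fun x => (1 + m - x.1, x.2)) (fun x => (1 + m - x.1, x.2)) hinv hinv
    ?_).congr (hinv (p, q)) (hinv (u, v)) ?_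
  · rintro ⟨x, y⟩ ⟨x', y'⟩
    simp only [supergrid_adj]
    omega
  · intro x y
    simp only [Set.mem_preimage, Set.mem_sdiff, Set.mem_singleton_iff, Prod.mk.injEq, mem_box,
      mem_ell]
    omega

/-- The upper part of an `L`-shape contains both ends. In general the upper part is traversed
through an edge of its last row, which is then replaced by a detour through the lower part. -/
theorem traverses_ell_of_top {m a l n p q u v : ℤ} (ha : 2 ≤ a) (ham : a < m) (hl : 2 ≤ l)
    (hln : l + 2 ≤ n) (hp : 1 ≤ p ∧ p ≤ a) (hu : 1 ≤ u ∧ u ≤ a) (hq : 1 ≤ q ∧ q ≤ l)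
    (hv : 1 ≤ v ∧ v ≤ l) (hne : p ≠ u ∨ q ≠ v) (hrow : a = 2 → q = v → q = 1) :
    Traverses (ell m a l n) (p, q) (u, v) := by
  have P := traverses_point
  have hR : ∀ x y, 1 ≤ x → x ≤ m → 1 ≤ y → y ≤ m → x ≠ y →
      Traverses (box 1 m (l + 1) n) (x, l + 1) (y, l + 1) := fun x y _ _ _ _ _ =>
    rectLinked (by omega) (by omega) _ _ _ _ (by constructor <;> omega)
  -- it suffices to find a traversal of the upper part that uses an edge on its lower side
  have ins : ∀ x, 1 ≤ x → x + 1 ≤ a → Via (box 1 a 1 l) (p, q) (u, v) (x, l) (x + 1, l) →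
      Traverses (ell m a l n) (p, q) (u, v) := fun x hx hxa h =>
    (h.insert (hR x (x + 1) hx (by omega) (by omega) (by omega) (by omega))).congr
  have hT : CornerLinked 1 a 1 l := cornerLinked (by omega) (by omega)
  -- a column of two points, which has to be left on both sides
  by_cases hcol : l = 2 ∧ p = u ∧ 1 < p ∧ p < a
  · obtain ⟨rfl, rfl, hp1, hpa⟩ := hcol
    have hleft : Traverses (box 1 (p - 1) 1 2) (p - 1, 1) (p - 1, 2) :=
      (uturn_left_via_end (a := 1) (b := p - 1) (c := 1) (by omega) (by omega) (by omega)
        (by omega)).traverses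
    have hright : Traverses (box (p + 1) a 1 2) (p + 1, 2) (p + 1, 1) :=
      uturn_right (a := p + 1) (b := a) (c := 1) (by omega) (by omega) (by omega) (by omega)
    have key : Traverses (ell m a 2 n) (p, 1) (p, 2) :=
      ((P p 1).append (hleft.append ((hR (p - 1) p (by omega) (by omega) (by omega) (by omega)
        (by omega)).append (hright.append (P p 2))))).congr
    obtain ⟨rfl, rfl⟩ | ⟨rfl, rfl⟩ : (q = 1 ∧ v = 2) ∨ (q = 2 ∧ v = 1) := by omega
    exacts [key, key.symm]
  obtain rfl | ha : a = 2 ∨ 3 ≤ a := by omega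
  · by_cases hdiag : l = 2 ∧ p ≠ u ∧ q ≠ v
    · obtain ⟨rfl, hpu, hqv⟩ := hdiag
      -- the diagonals of a square that sits on top of a rectangle
      have key : Traverses (ell m 2 2 n) (1, 1) (2, 2) :=
        ((P 1 1).append ((P 2 1).append ((P 1 2).append ((hR 1 2 (by omega) (by omega) (by omega)
          (by omega) (by omega)).append (P 2 2))))).congr
      have key' : Traverses (ell m 2 2 n) (2, 1) (1, 2) :=
        ((P 2 1).append ((P 1 1).append ((P 2 2).append ((hR 2 1 (by omega) (by omega) (by omega)
          (by omega) (by omega)).append (P 1 2))))).congr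
      obtain ⟨rfl, rfl⟩ | ⟨rfl, rfl⟩ : (p = 1 ∧ u = 2) ∨ (p = 2 ∧ u = 1) := by omega
      · obtain ⟨rfl, rfl⟩ | ⟨rfl, rfl⟩ : (q = 1 ∧ v = 2) ∨ (q = 2 ∧ v = 1) := by omega
        exacts [key, key'.symm]
      · obtain ⟨rfl, rfl⟩ | ⟨rfl, rfl⟩ : (q = 1 ∧ v = 2) ∨ (q = 2 ∧ v = 1) := by omega
        exacts [key', key.symm]
    · have h := (hT p (1 + l - q) u (1 + l - v) (by constructor <;> omega) (by omega)
        (by omega)).flip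
      exact ins 1 le_rfl le_rfl h.congr
  · obtain ⟨x, hx, hxa, h⟩ := hT.exists_top_edge (p := p) (q := 1 + l - q) (u := u)
      (v := 1 + l - v) (by omega) (by constructor <;> omega)
    exact ins x hx hxa h.flip.congr

/-- One end lies in the upper part of an `L`-shape and the other one below it. -/
theorem traverses_ell_of_cross {m a l n p q u v : ℤ} (ha : 2 ≤ a) (ham : a < m) (hl : 2 ≤ l)
    (hln : l + 2 ≤ n) (hp : 1 ≤ p ∧ p ≤ a) (hu : 1 ≤ u ∧ u ≤ m) (hq : 1 ≤ q ∧ q ≤ l)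
    (hv : l + 1 ≤ v ∧ v ≤ n) : Traverses (ell m a l n) (p, q) (u, v) := by
  obtain ⟨x, y, hx, hy, hxp, hyu, hxy⟩ := exists_near_avoiding (show 1 < a by omega) p u
  exact ((rectLinked (a := 1) (b := a) (c := 1) (d := l) (by omega) (by omega) p q x l
    (by constructor <;> omega)).append (rectLinked (a := 1) (b := m) (c := l + 1) (d := n)
      (by omega) (by omega) y (l + 1) u v (by constructor <;> omega))).congr

/-- The part of an `L`-shape below its upper part contains both ends. In general this part is
traversed through the edge in its upper left corner, which is then replaced by a detour through the
upper part. -/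
theorem traverses_ell_of_bottom {m a l n p q u v : ℤ} (ha : 2 ≤ a) (ham : a < m) (hl : 2 ≤ l)
    (hln : l + 2 ≤ n) (hp : 1 ≤ p ∧ p ≤ m) (hu : 1 ≤ u ∧ u ≤ m) (hq : l + 1 ≤ q ∧ q ≤ n)
    (hv : l + 1 ≤ v ∧ v ≤ n) (hne : p ≠ u ∨ q ≠ v)
    (hcol : n = l + 2 → p = u → p ≤ a ∨ p = m) :
    Traverses (ell m a l n) (p, q) (u, v) := by
  have P := traverses_point
  have hR : CornerLinked 1 m (l + 1) n := cornerLinked (by omega) (by omega)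
  have hT : ∀ x, 1 ≤ x → x + 1 ≤ a → Traverses (box 1 a 1 l) (x, l) (x + 1, l) := fun x _ _ =>
    rectLinked (by omega) (by omega) _ _ _ _ (by constructor <;> omega)
  have hT₁ : Traverses (box 1 a 1 l) (1, l) (2, l) := hT 1 le_rfl ha
  -- a column of two points, which has to be left on both sides
  by_cases hE : n = l + 2 ∧ p = u ∧ 1 < p ∧ p < m
  · obtain ⟨rfl, rfl, hp1, hpm⟩ := hE
    have hleft : Traverses (box 1 (p - 1) (l + 1) (l + 2)) (p - 1, l + 2) (p - 1, l + 1) :=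
      (uturn_left_via_end (a := 1) (b := p - 1) (c := l + 1) (q := l + 2) (v := l + 1) (by omega)
        (by omega) (by omega) (by omega)).traverses.congr
    have hright : Traverses (box (p + 1) m (l + 1) (l + 2)) (p + 1, l + 1) (p + 1, l + 2) :=
      (uturn_right (a := p + 1) (b := m) (c := l + 1) (q := l + 1) (v := l + 2) (by omega)
        (by omega) (by omega) (by omega)).congr
    have key : Traverses (ell m a l (l + 2)) (p, l + 1) (p, l + 2) :=
      ((P p (l + 1)).append (hleft.append ((hT (p - 1) (by omega) (by omega)).append
        (hright.append (P p (l + 2)))))).congr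
    obtain ⟨rfl, rfl⟩ | ⟨rfl, rfl⟩ : (q = l + 1 ∧ v = l + 2) ∨ (q = l + 2 ∧ v = l + 1) := by
      omega
    exacts [key, key.symm]
  -- the pairs for which no traversal of the lower part uses the edge below the corner of the
  -- upper part
  have special : ∀ q v, l + 1 ≤ q ∧ q ≤ n → l + 1 ≤ v ∧ v ≤ n →
      (q = l + 1 ∧ v = l + 1) ∨ (n = l + 2 ∧ q ≠ v) →
      Traverses (ell m a l n) (1, q) (2, v) := by
    intro q v hq hv h
    by_cases hq' : q = l + 1
    · subst hq'
      exact ((P 1 (l + 1)).append (hT₁.append ((hR.rectLinked (by omega) (by omega)).cornerless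
        (p := 3) (q := l + 1) (u := 2) (v := v) (by constructor <;> omega) (by omega)
          (by omega)))).congr
    · obtain rfl : n = l + 2 := by omega
      obtain rfl : q = l + 2 := by omega
      obtain rfl : v = l + 1 := by omega
      have hright : Traverses (box 3 m (l + 1) (l + 2)) (3, l + 1) (3, l + 2) :=
        (uturn_right (a := 3) (b := m) (c := l + 1) (q := l + 1) (v := l + 2) (by omega)
          (by omega) (by omega) (by omega)).congr
      exact ((P 1 (l + 2)).append ((P 1 (l + 1)).append (hT₁.append (hright.append
        ((P 2 (l + 2)).append (P 2 (l + 1))))))).congr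
  by_cases hbad : (p ≤ 2 ∧ u ≤ 2 ∧ p ≠ u) ∧
      ((q = l + 1 ∧ v = l + 1) ∨ (n = l + 2 ∧ q ≠ v))
  · obtain ⟨⟨hp2, hu2, hpu⟩, h⟩ := hbad
    obtain ⟨rfl, rfl⟩ | ⟨rfl, rfl⟩ : (p = 1 ∧ u = 2) ∨ (p = 2 ∧ u = 1) := by omega
    · exact special q v hq hv h
    · exact (special v q hv hq (by omega)).symm
  · have h : Via (box 1 m (l + 1) n) (p, q) (u, v) (1, l + 1) (2, l + 1) :=
      hR p q u v (by constructor <;> omega) (by omega) (by omega)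
    exact (h.insert hT₁).congr

/-- `L`-shapes whose upper part is a single column, traversed from the top of this column. -/
theorem traverses_ell_of_column_start {m l n u v : ℤ} (hm : 1 < m) (hl : 1 ≤ l) (hln : l < n)
    (hu : 1 ≤ u ∧ u ≤ m) (hv : l + 1 ≤ v ∧ v ≤ n)
    (hend : n = l + 1 → 3 ≤ m → u = m) : Traverses (ell m 1 l n) (1, 1) (u, v) := by
  have P := traverses_point
  have hT := traverses_col 1 hl
  obtain rfl | hn : n = l + 1 ∨ l + 2 ≤ n := by omega
  · obtain rfl : v = l + 1 := by omega
    by_cases hum : u = m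
    · subst hum
      exact (hT.append (traverses_row (l + 1) (show 1 ≤ u by omega))).congr
    · obtain rfl : m = 2 := by omega
      obtain rfl : u = 1 := by omega
      exact (hT.append ((P 2 (l + 1)).append (P 1 (l + 1)))).congr
  · have hR : RectLinked 1 m (l + 1) n := rectLinked hm (by omega)
    by_cases ht : u = 1 ∧ v = l + 1
    · exact (hT.append (hR 2 (l + 1) u v (by constructor <;> omega))).congr
    · exact (hT.append (hR 1 (l + 1) u v (by constructor <;> omega))).congr

/-- A rectangle with a single point on top of its first column, which is not an end. -/
theorem traverses_ell_of_point {m n p q u v : ℤ} (hm : 3 ≤ m) (hn : 1 < n)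
    (hp : 1 ≤ p ∧ p ≤ m) (hu : 1 ≤ u ∧ u ≤ m) (hq : 2 ≤ q ∧ q ≤ n) (hv : 2 ≤ v ∧ v ≤ n)
    (hne : p ≠ u ∨ q ≠ v) (hedge : p ≤ 2 → u ≤ 2 → q = 2 → v ≠ 2)
    (hcol : n = 3 → p = u → p = 1 ∨ p = m)
    (hdiag : n = 3 → p ≤ 2 → u ≤ 2 → p ≠ u → q = 3 ∧ v = 3)
    (hrow : n = 2 → p = 1 ∧ u = m ∨ p = m ∧ u = 1) :
    Traverses (ell m 1 1 n) (p, q) (u, v) := by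
  have P := traverses_point
  obtain rfl | hn : n = 2 ∨ 3 ≤ n := by omega
  · obtain rfl : q = 2 := by omega
    obtain rfl : v = 2 := by omega
    have key : Traverses (ell m 1 1 2) (1, 2) (m, 2) :=
      ((P 1 2).append ((P 1 1).append (traverses_row 2 (show 2 ≤ m by omega)))).congr
    obtain ⟨rfl, rfl⟩ | ⟨rfl, rfl⟩ := hrow rfl
    exacts [key, key.symm]
  · have h : Via (box 1 m 2 n) (p, q) (u, v) (1, 2) (2, 2) :=
      cornerLinked (by omega) (by omega) p q u v (by constructor <;> omega) (by omega) (by omega)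
    exact (h.insert (P 1 1)).congr

/-! ### Necessary conditions for a traversal -/

/-- Removing `S` separates the points of `A`: there are points of `A` outside `S` both inside and
outside of a set `B` which no edge between points of `A` outside `S` leaves. -/
def Separated (A S : Set (ℤ × ℤ)) : Prop :=
  ∃ B : Set (ℤ × ℤ), (∃ x ∈ A \ S, x ∈ B) ∧ (∃ x ∈ A \ S, x ∉ B) ∧
    ∀ x ∈ A \ S, ∀ y ∈ A \ S, supergrid.Adj x y → x ∈ B → y ∈ B

theorem Separated.of_coords {A S : Set (ℤ × ℤ)} (P : ℤ → ℤ → Prop) (x y x' y' : ℤ)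
    (h : (x, y) ∈ A ∧ (x, y) ∉ S ∧ P x y) (h' : (x', y') ∈ A ∧ (x', y') ∉ S ∧ ¬P x' y')
    (hP : ∀ x y x' y', (x, y) ∈ A ∧ (x, y) ∉ S → (x', y') ∈ A ∧ (x', y') ∉ S →
      supergrid.Adj (x, y) (x', y') → P x y → P x' y') : Separated A S :=
  ⟨{z | P z.1 z.2}, ⟨(x, y), ⟨h.1, h.2.1⟩, h.2.2⟩, ⟨(x', y'), ⟨h'.1, h'.2.1⟩, h'.2.2⟩,
    fun z hz w hw => hP z.1 z.2 w.1 w.2 hz hw⟩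

/-- Inside `A`, the point `w` has exactly one neighbour. -/
def IsLeaf (A : Set (ℤ × ℤ)) (w : ℤ × ℤ) : Prop :=
  ∃ x ∈ A, supergrid.Adj w x ∧ ∀ y ∈ A, supergrid.Adj w y → y = x

/-- The exceptional pairs of ends in the `L`-shape with a single point on top of a rectangle of
two rows. -/
def Twisted (m a l n : ℤ) (s t : ℤ × ℤ) : Prop :=
  a = 1 ∧ l = 1 ∧ n = 3 ∧ 3 ≤ m ∧
    (s = (1, 2) ∧ t = (2, 3) ∨ s = (2, 3) ∧ t = (1, 2) ∨
      s = (1, 3) ∧ t = (2, 2) ∨ s = (2, 2) ∧ t = (1, 3))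

/-- The reflection which carries the `L`-shape of `m` columns and `n` rows to one of `n` columns
and `m` rows. -/
def reflectL (m n : ℤ) (v : ℤ × ℤ) : ℤ × ℤ := (n + 1 - v.2, m + 1 - v.1)

/-- None of the obstructions to a traversal of an `L`-shape from `s` to `t` occurs. -/
structure Admissible (m a l n : ℤ) (s t : ℤ × ℤ) : Prop where
  start_mem : s ∈ ell m a l n
  end_mem : t ∈ ell m a l n
  ne : s ≠ t
  not_separated_start : ¬Separated (ell m a l n) {s}
  not_separated_end : ¬Separated (ell m a l n) {t}
  not_separated_pair : ¬Separated (ell m a l n) {s, t}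
  not_leaf : ∀ w ∈ ell m a l n, w ≠ s → w ≠ t → ¬IsLeaf (ell m a l n) w
  not_twisted : ¬Twisted m a l n s t
  not_twisted_reflect : ¬Twisted n (n - l) (m - a) m (reflectL m n s) (reflectL m n t)

/-- A set that is closed under adjacency within `A` contains all of `A` or nothing of it. -/
theorem Traverses.mem_iff_of_closed {A : Set (ℤ × ℤ)} {s t : ℤ × ℤ} (h : Traverses A s t)
    {B : Set (ℤ × ℤ)} (hB : ∀ x ∈ A, ∀ y ∈ A, supergrid.Adj x y → x ∈ B → y ∈ B) :
    ∀ x ∈ A, x ∈ B ↔ s ∈ B := by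
  induction h with
  | single v => rintro x rfl; rfl
  | @cons A u v w hu huv hA ih =>
    have hv := hA.start_mem
    have huv' : v ∈ B ↔ u ∈ B :=
      ⟨hB v (Or.inr hv) u (Or.inl rfl) huv.symm, hB u (Or.inl rfl) v (Or.inr hv) huv⟩
    rintro x (rfl | hx)
    · rfl
    · exact (ih (fun x hx y hy => hB x (Or.inr hx) y (Or.inr hy)) x hx).trans huv'

theorem Traverses.not_separated {A S C : Set (ℤ × ℤ)} {s t : ℤ × ℤ} (h : Traverses C s t)
    (hC : C = A \ S) : ¬Separated A S := by
  subst hC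
  rintro ⟨B, ⟨x, hx, hxB⟩, ⟨y, hy, hyB⟩, hB⟩
  have := h.mem_iff_of_closed hB
  exact hyB ((this y hy).mpr ((this x hx).mp hxB))

theorem Traverses.uncons {A : Set (ℤ × ℤ)} {s t : ℤ × ℤ} (h : Traverses A s t) (hst : s ≠ t) :
    ∃ v, supergrid.Adj s v ∧ Traverses (A \ {s}) v t := by
  cases h with
  | single => exact absurd rfl hst
  | @cons A _ v _ hu huv hA =>
    refine ⟨v, huv, ?_⟩
    rwa [Set.insert_sdiff_of_mem _ (Set.mem_singleton s), Set.sdiff_singleton_eq_self hu]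

theorem Traverses.eq_singleton {A : Set (ℤ × ℤ)} {s : ℤ × ℤ} (h : Traverses A s s) : A = {s} := by
  cases h with
  | single => rfl
  | cons hu _ hA => exact absurd hA.end_mem hu

theorem Traverses.not_separated_start {A : Set (ℤ × ℤ)} {s t : ℤ × ℤ} (h : Traverses A s t)
    (hst : s ≠ t) : ¬Separated A {s} := by
  obtain ⟨v, -, hv⟩ := h.uncons hst
  exact hv.not_separated rfl

theorem Traverses.not_separated_pair {A : Set (ℤ × ℤ)} {s t : ℤ × ℤ} (h : Traverses A s t)
    (hst : s ≠ t) : ¬Separated A {s, t} := by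
  obtain ⟨v, hsv, hv⟩ := h.uncons hst
  have hA : A \ {s, t} = (A \ {s}) \ {t} := by
    rw [Set.sdiff_sdiff, Set.singleton_union]
  by_cases hvt : v = t
  · subst hvt
    rintro ⟨B, ⟨x, hx, -⟩, -⟩
    rw [hA, hv.eq_singleton] at hx
    exact hx.2 hx.1
  · obtain ⟨w, -, hw⟩ := hv.symm.uncons (Ne.symm hvt)
    exact hw.not_separated hA.symm

theorem Traverses.not_leaf {A : Set (ℤ × ℤ)} {s t w : ℤ × ℤ} (h : Traverses A s t) (hw : w ∈ A)
    (hws : w ≠ s) (hwt : w ≠ t) : ¬IsLeaf A w := by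
  rintro ⟨x, -, -, hx⟩
  obtain ⟨B, C, p, q, hB, hC, hp, hq, hBC, -, -, rfl⟩ := h.split hw hws hwt
  have hpx := hx p (Or.inl hB.end_mem) hp.symm
  have hqx := hx q (Or.inr (Or.inr hC.start_mem)) hq
  exact hBC p hB.end_mem (by rw [hpx, ← hqx]; exact hC.start_mem)

/-- A leaf `(x, y)`, with the neighbour `(x', y')`, can only be an end of a traversal. -/
theorem Traverses.eq_start_of_leaf {A : Set (ℤ × ℤ)} {s t : ℤ × ℤ} {x y : ℤ}
    (h : Traverses A s t) (hw : (x, y) ∈ A) (hwt : (x, y) ≠ t) (x' y' : ℤ) (hx : (x', y') ∈ A)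
    (hadj : supergrid.Adj (x, y) (x', y'))
    (huniq : ∀ p q, (p, q) ∈ A → supergrid.Adj (x, y) (p, q) → p = x' ∧ q = y') :
    (x, y) = s := by
  by_contra hws
  exact h.not_leaf hw hws hwt ⟨(x', y'), hx, hadj, fun z hz hz' =>
    Prod.ext (huniq z.1 z.2 hz hz').1 (huniq z.1 z.2 hz hz').2⟩

/-- With the ends `(1, 2)` and `(2, 3)`, the first steps `(1, 2), (1, 1), (2, 2), (1, 3), (2, 3)`
are forced, and the path ends before it has reached the third column. -/
theorem not_traverses_of_twisted_edge {m : ℤ} (hm : 3 ≤ m) :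
    ¬Traverses (ell m 1 1 3) (1, 2) (2, 3) := by
  intro h
  obtain ⟨v₁, -, h₁⟩ := h.uncons (by decide)
  -- without `(1, 2)`, the upper point is a leaf
  obtain rfl := h₁.eq_start_of_leaf (x := 1) (y := 1)
    (by simp only [Set.mem_sdiff, Set.mem_singleton_iff, Prod.mk.injEq, mem_ell]; omega)
    (by decide) 2 2
    (by simp only [Set.mem_sdiff, Set.mem_singleton_iff, Prod.mk.injEq, mem_ell]; omega)
    (by rw [supergrid_adj]; omega)
    (by
      simp only [Set.mem_sdiff, Set.mem_singleton_iff, Prod.mk.injEq, mem_ell, supergrid_adj]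
      omega)
  obtain ⟨⟨x, y⟩, hadj, h₂⟩ := h₁.uncons (by decide)
  have hmem := h₂.start_mem
  simp only [Set.mem_sdiff, Set.mem_singleton_iff, Prod.mk.injEq, mem_ell, supergrid_adj]
    at hmem hadj
  obtain ⟨rfl, rfl⟩ : x = 2 ∧ y = 2 := by omega
  obtain ⟨v₃, -, h₃⟩ := h₂.uncons (by decide)
  -- now the same holds for `(1, 3)`
  obtain rfl := h₃.eq_start_of_leaf (x := 1) (y := 3)
    (by simp only [Set.mem_sdiff, Set.mem_singleton_iff, Prod.mk.injEq, mem_ell]; omega)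
    (by decide) 2 3
    (by simp only [Set.mem_sdiff, Set.mem_singleton_iff, Prod.mk.injEq, mem_ell]; omega)
    (by rw [supergrid_adj]; omega)
    (by
      simp only [Set.mem_sdiff, Set.mem_singleton_iff, Prod.mk.injEq, mem_ell, supergrid_adj]
      omega)
  obtain ⟨⟨x, y⟩, hadj, h₄⟩ := h₃.uncons (by decide)
  have hmem := h₄.start_mem
  simp only [Set.mem_sdiff, Set.mem_singleton_iff, Prod.mk.injEq, mem_ell, supergrid_adj]
    at hmem hadj
  obtain ⟨rfl, rfl⟩ : x = 2 ∧ y = 3 := by omega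
  have h32 := Set.ext_iff.mp h₄.eq_singleton (3, 2)
  simp only [Set.mem_sdiff, Set.mem_singleton_iff, Prod.mk.injEq, mem_ell] at h32
  omega

/-- With the ends `(2, 2)` and `(1, 3)`, the path has to start with `(2, 2), (1, 1), (1, 2)` and can
then visit at most `(2, 3)` before its end. -/
theorem not_traverses_of_twisted_diagonal {m : ℤ} (hm : 3 ≤ m) :
    ¬Traverses (ell m 1 1 3) (2, 2) (1, 3) := by
  intro h
  obtain ⟨v₁, -, h₁⟩ := h.uncons (by decide)
  -- without `(2, 2)`, the upper point is a leaf
  obtain rfl := h₁.eq_start_of_leaf (x := 1) (y := 1)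
    (by simp only [Set.mem_sdiff, Set.mem_singleton_iff, Prod.mk.injEq, mem_ell]; omega)
    (by decide) 1 2
    (by simp only [Set.mem_sdiff, Set.mem_singleton_iff, Prod.mk.injEq, mem_ell]; omega)
    (by rw [supergrid_adj]; omega)
    (by
      simp only [Set.mem_sdiff, Set.mem_singleton_iff, Prod.mk.injEq, mem_ell, supergrid_adj]
      omega)
  obtain ⟨⟨x, y⟩, hadj, h₂⟩ := h₁.uncons (by decide)
  have hmem := h₂.start_mem
  simp only [Set.mem_sdiff, Set.mem_singleton_iff, Prod.mk.injEq, mem_ell, supergrid_adj]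
    at hmem hadj
  obtain ⟨rfl, rfl⟩ : x = 1 ∧ y = 2 := by omega
  obtain ⟨⟨x, y⟩, hadj₃, h₃⟩ := h₂.uncons (by decide)
  have hmem₃ := h₃.start_mem
  -- without `(1, 2)` and `(2, 2)`, the only neighbour of the end `(1, 3)` is `(2, 3)`
  obtain ⟨rfl, rfl⟩ | ⟨rfl, rfl⟩ : (x = 1 ∧ y = 3) ∨ (x = 2 ∧ y = 3) := by
    simp only [Set.mem_sdiff, Set.mem_singleton_iff, Prod.mk.injEq, mem_ell, supergrid_adj]
      at hmem₃ hadj₃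
    omega
  · have h32 := Set.ext_iff.mp h₃.eq_singleton (3, 2)
    simp only [Set.mem_sdiff, Set.mem_singleton_iff, Prod.mk.injEq, mem_ell] at h32
    omega
  · obtain ⟨⟨x, y⟩, hadj₄, h₄⟩ := h₃.symm.uncons (by decide)
    have hmem₄ := h₄.start_mem
    simp only [Set.mem_sdiff, Set.mem_singleton_iff, Prod.mk.injEq, mem_ell, supergrid_adj]
      at hmem₄ hadj₄
    obtain ⟨rfl, rfl⟩ : x = 2 ∧ y = 3 := by omega
    have h32 := Set.ext_iff.mp h₄.eq_singleton (3, 2)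
    simp only [Set.mem_sdiff, Set.mem_singleton_iff, Prod.mk.injEq, mem_ell] at h32
    omega

theorem Traverses.not_twisted {m a l n : ℤ} {s t : ℤ × ℤ} (h : Traverses (ell m a l n) s t) :
    ¬Twisted m a l n s t := by
  rintro ⟨rfl, rfl, rfl, hm, ⟨rfl, rfl⟩ | ⟨rfl, rfl⟩ | ⟨rfl, rfl⟩ | ⟨rfl, rfl⟩⟩
  exacts [not_traverses_of_twisted_edge hm h, not_traverses_of_twisted_edge hm h.symm,
    not_traverses_of_twisted_diagonal hm h.symm, not_traverses_of_twisted_diagonal hm h]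

theorem reflectL_reflectL (m n : ℤ) (v : ℤ × ℤ) : reflectL n m (reflectL m n v) = v := by
  simp [reflectL]

theorem reflectL_adj (m n : ℤ) (v w : ℤ × ℤ) (h : supergrid.Adj v w) :
    supergrid.Adj (reflectL m n v) (reflectL m n w) := by
  obtain ⟨x, y⟩ := v
  obtain ⟨x', y'⟩ := w
  simp only [reflectL, supergrid_adj] at h ⊢
  omega

theorem reflectL_mem_ell {m a l n : ℤ} {v : ℤ × ℤ} :
    reflectL m n v ∈ ell n (n - l) (m - a) m ↔ v ∈ ell m a l n := by
  obtain ⟨x, y⟩ := v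
  simp only [reflectL, mem_ell]
  omega

theorem preimage_reflectL (m a l n : ℤ) :
    reflectL n m ⁻¹' ell m a l n = ell n (n - l) (m - a) m := by
  ext v
  rw [Set.mem_preimage, ← reflectL_mem_ell, reflectL_reflectL]

theorem Traverses.reflect {m a l n : ℤ} {s t : ℤ × ℤ} (h : Traverses (ell m a l n) s t) :
    Traverses (ell n (n - l) (m - a) m) (reflectL m n s) (reflectL m n t) := by
  rw [← preimage_reflectL]
  exact h.map _ _ (reflectL_reflectL m n) (reflectL_reflectL n m) (reflectL_adj m n)

theorem Traverses.admissible {m a l n : ℤ} {s t : ℤ × ℤ} (h : Traverses (ell m a l n) s t)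
    (hst : s ≠ t) : Admissible m a l n s t where
  start_mem := h.start_mem
  end_mem := h.end_mem
  ne := hst
  not_separated_start := h.not_separated_start hst
  not_separated_end := h.symm.not_separated_start hst.symm
  not_separated_pair := h.not_separated_pair hst
  not_leaf _ := h.not_leaf
  not_twisted := h.not_twisted
  not_twisted_reflect := h.reflect.not_twisted

theorem Separated.reflect {m a l n : ℤ} {S : Set (ℤ × ℤ)}
    (h : Separated (ell n (n - l) (m - a) m) (reflectL n m ⁻¹' S)) :
    Separated (ell m a l n) S := by
  have hmem : ∀ x, reflectL n m x ∈ ell m a l n \ S ↔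
      x ∈ ell n (n - l) (m - a) m \ reflectL n m ⁻¹' S := fun x => by
    rw [← preimage_reflectL, Set.mem_sdiff, Set.mem_sdiff, Set.mem_preimage, Set.mem_preimage]
  have hmem' : ∀ x ∈ ell m a l n \ S, reflectL m n x ∈
      ell n (n - l) (m - a) m \ reflectL n m ⁻¹' S := fun x hx => by
    rw [← hmem, reflectL_reflectL]
    exact hx
  obtain ⟨B, ⟨x, hx, hxB⟩, ⟨y, hy, hyB⟩, hB⟩ := h
  refine ⟨reflectL m n ⁻¹' B, ⟨reflectL n m x, (hmem x).2 hx, ?_⟩,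
    ⟨reflectL n m y, (hmem y).2 hy, ?_⟩, fun v hv w hw hvw hvB => ?_⟩
  · rwa [Set.mem_preimage, reflectL_reflectL]
  · rwa [Set.mem_preimage, reflectL_reflectL]
  · exact hB _ (hmem' v hv) _ (hmem' w hw) (reflectL_adj m n v w hvw) hvB

theorem IsLeaf.reflect {m a l n : ℤ} {w : ℤ × ℤ}
    (h : IsLeaf (ell n (n - l) (m - a) m) w) : IsLeaf (ell m a l n) (reflectL n m w) := by
  obtain ⟨x, hx, hwx, huniq⟩ := h
  refine ⟨reflectL n m x, ?_, reflectL_adj n m w x hwx, fun y hy hwy => ?_⟩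
  · rwa [← reflectL_mem_ell, reflectL_reflectL]
  · rw [← huniq (reflectL m n y) (reflectL_mem_ell.2 hy)
      (by simpa only [reflectL_reflectL] using reflectL_adj m n _ _ hwy), reflectL_reflectL]

theorem Admissible.symm {m a l n : ℤ} {s t : ℤ × ℤ} (h : Admissible m a l n s t) :
    Admissible m a l n t s where
  start_mem := h.end_mem
  end_mem := h.start_mem
  ne := h.ne.symm
  not_separated_start := h.not_separated_end
  not_separated_end := h.not_separated_start
  not_separated_pair := by
    rw [Set.pair_comm]
    exact h.not_separated_pair
  not_leaf w hw hwt hws := h.not_leaf w hw hws hwt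
  not_twisted h' := h.not_twisted (by unfold Twisted at h' ⊢; tauto)
  not_twisted_reflect h' := h.not_twisted_reflect (by unfold Twisted at h' ⊢; tauto)

theorem Admissible.reflect {m a l n : ℤ} {s t : ℤ × ℤ} (h : Admissible m a l n s t) :
    Admissible n (n - l) (m - a) m (reflectL m n s) (reflectL m n t) := by
  have hinj : ∀ v w, v = reflectL m n w ↔ reflectL n m v = w := fun v w =>
    ⟨fun h => by rw [h, reflectL_reflectL], fun h => by rw [← h, reflectL_reflectL]⟩
  have hpre : ∀ v : ℤ × ℤ, {reflectL m n v} = reflectL n m ⁻¹' {v} := fun v =>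
    Set.ext fun w => hinj w v
  refine ⟨reflectL_mem_ell.2 h.start_mem, reflectL_mem_ell.2 h.end_mem, ?_, ?_, ?_, ?_, ?_,
    h.not_twisted_reflect, ?_⟩
  · intro h'
    rw [hinj, reflectL_reflectL] at h'
    exact h.ne h'
  · rw [hpre]
    exact fun h' => h.not_separated_start h'.reflect
  · rw [hpre]
    exact fun h' => h.not_separated_end h'.reflect
  · rw [show ({reflectL m n s, reflectL m n t} : Set (ℤ × ℤ)) = reflectL n m ⁻¹' {s, t} from
      Set.ext fun w => or_congr (hinj w s) (hinj w t)]
    exact fun h' => h.not_separated_pair h'.reflect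
  · intro w hw hws hwt h'
    rw [ne_eq, hinj] at hws hwt
    exact h.not_leaf _ (by rwa [← reflectL_mem_ell, reflectL_reflectL]) hws hwt h'.reflect
  · rw [sub_sub_cancel, sub_sub_cancel, reflectL_reflectL, reflectL_reflectL]
    exact h.not_twisted

/-! ### Sufficiency of the conditions -/

theorem Admissible.upper_column_start {m l n u v : ℤ} (h : Admissible m 1 l n (1, 1) (u, v))
    (hm : 1 < m) (hl : 1 ≤ l) (hln : l < n) :
    Traverses (ell m 1 l n) (1, 1) (u, v) := by
  have ht := h.end_mem
  have hne := h.ne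
  rw [mem_ell] at ht
  rw [ne_eq, Prod.mk.injEq] at hne
  have hv : l < v := by
    by_contra hv
    -- otherwise `t` is a cut vertex
    refine h.not_separated_end (Separated.of_coords (fun _ y => y < v) 1 1 1 n ?_ ?_ ?_)
    all_goals simp only [mem_ell, Set.mem_singleton_iff, Prod.mk.injEq, supergrid_adj]
    all_goals omega
  refine traverses_ell_of_column_start hm hl hln (by omega) (by omega) fun hn hm3 => ?_
  by_contra hum
  -- otherwise the last point of the only long row is a leaf
  refine h.not_leaf (m, n) ?_ ?_ ?_ ⟨(m - 1, n), ?_, ?_, ?_⟩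
  iterate 5
    simp only [mem_ell, ne_eq, Prod.mk.injEq, supergrid_adj]
    omega
  rintro ⟨x, y⟩
  simp only [mem_ell, Prod.mk.injEq, supergrid_adj]
  omega

theorem Admissible.traverses_of_upper_column {m l n p q u v : ℤ}
    (h : Admissible m 1 l n (p, q) (u, v)) (hm : 1 < m) (hl : 1 ≤ l) (hln : l < n)
    (hml : 3 ≤ m ∨ 2 ≤ l) : Traverses (ell m 1 l n) (p, q) (u, v) := by
  by_cases hs : p = 1 ∧ q = 1
  · obtain ⟨rfl, rfl⟩ := hs
    exact h.upper_column_start hm hl hln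
  by_cases ht : u = 1 ∧ v = 1
  · obtain ⟨rfl, rfl⟩ := ht
    exact (h.symm.upper_column_start hm hl hln).symm
  have hsm := h.start_mem
  have htm := h.end_mem
  have hne := h.ne
  rw [mem_ell] at hsm htm
  rw [ne_eq, Prod.mk.injEq] at hne
  obtain rfl : l = 1 := by
    by_contra hl1
    refine h.not_leaf (1, 1) ?_ ?_ ?_ ⟨(1, 2), ?_, ?_, ?_⟩
    iterate 5
      simp only [mem_ell, ne_eq, Prod.mk.injEq, supergrid_adj]
      omega
    rintro ⟨x, y⟩
    simp only [mem_ell, Prod.mk.injEq, supergrid_adj]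
    omega
  have hedge : p ≤ 2 → u ≤ 2 → q = 2 → v ≠ 2 := by
    rintro hp hu rfl rfl
    refine h.not_separated_pair (Separated.of_coords (fun _ y => y < 2) 1 1 3 2 ?_ ?_ ?_)
    all_goals
      clear h hs ht
      simp only [mem_ell, Set.mem_insert_iff, Set.mem_singleton_iff, Prod.mk.injEq,
        supergrid_adj]
      obtain ⟨rfl, rfl⟩ | ⟨rfl, rfl⟩ : (p = 1 ∧ u = 2) ∨ (p = 2 ∧ u = 1) := by omega
      all_goals omega
  refine traverses_ell_of_point (by omega) hln (by omega) (by omega) (by omega) (by omega)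
    (by omega) hedge ?_ ?_ ?_
  · rintro rfl rfl
    by_contra hp
    refine h.not_separated_pair (Separated.of_coords (fun x _ => x < p) 1 1 m 2 ?_ ?_ ?_)
    all_goals simp only [mem_ell, Set.mem_insert_iff, Set.mem_singleton_iff, Prod.mk.injEq,
      supergrid_adj]
    all_goals omega
  · rintro rfl hp hu hpu
    by_contra hqv
    refine h.not_twisted ⟨rfl, rfl, rfl, by omega, ?_⟩
    simp only [Prod.mk.injEq]
    omega
  · rintro rfl
    have hend : p = m ∨ u = m := by
      by_contra hend
      refine h.not_leaf (m, 2) ?_ ?_ ?_ ⟨(m - 1, 2), ?_, ?_, ?_⟩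
      iterate 5
        simp only [mem_ell, ne_eq, Prod.mk.injEq, supergrid_adj]
        omega
      rintro ⟨x, y⟩
      simp only [mem_ell, Prod.mk.injEq, supergrid_adj]
      omega
    have hp : p = 1 ∨ p = m := by
      by_contra hp
      refine h.not_separated_start (Separated.of_coords (fun x _ => x < p) 1 1 m 2 ?_ ?_ ?_)
      all_goals simp only [mem_ell, Set.mem_singleton_iff, Prod.mk.injEq, supergrid_adj]
      all_goals omega
    have hu : u = 1 ∨ u = m := by
      by_contra hu
      refine h.not_separated_end (Separated.of_coords (fun x _ => x < u) 1 1 m 2 ?_ ?_ ?_)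
      all_goals simp only [mem_ell, Set.mem_singleton_iff, Prod.mk.injEq, supergrid_adj]
      all_goals omega
    omega

theorem Admissible.traverses_of_corner {m n p q u v : ℤ}
    (h : Admissible m (m - 1) 1 n (p, q) (u, v)) (hm : 1 < m) (hn : 1 < n) :
    Traverses (ell m (m - 1) 1 n) (p, q) (u, v) := by
  have hs := h.start_mem
  have ht := h.end_mem
  have hne := h.ne
  rw [ne_eq, Prod.mk.injEq] at hne
  refine traverses_ell_of_corner hm hn hs ht (by omega) ?_ ?_
  · rintro rfl rfl
    rw [mem_ell] at hs ht
    by_contra hp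
    refine h.not_separated_pair (Separated.of_coords (fun x _ => x < p) 1 2 m 2 ?_ ?_ ?_)
    all_goals simp only [mem_ell, Set.mem_insert_iff, Set.mem_singleton_iff, Prod.mk.injEq,
      supergrid_adj]
    all_goals omega
  · rintro rfl rfl
    rw [mem_ell] at hs ht
    by_contra hq
    refine h.not_separated_pair (Separated.of_coords (fun _ y => y < q) 1 1 1 n ?_ ?_ ?_)
    all_goals simp only [mem_ell, Set.mem_insert_iff, Set.mem_singleton_iff, Prod.mk.injEq,
      supergrid_adj]
    all_goals omega

theorem Admissible.traverses_of_thick {m a l n p q u v : ℤ}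
    (h : Admissible m a l n (p, q) (u, v)) (ha : 2 ≤ a) (ham : a < m) (hl : 2 ≤ l)
    (hln : l + 2 ≤ n) : Traverses (ell m a l n) (p, q) (u, v) := by
  have hs := h.start_mem
  have ht := h.end_mem
  have hne := h.ne
  rw [ne_eq, Prod.mk.injEq] at hne
  rw [mem_ell] at hs ht
  by_cases hq : q ≤ l
  · by_cases hv : v ≤ l
    · refine traverses_ell_of_top ha ham hl hln (by omega) (by omega) (by omega) (by omega)
        (by omega) ?_
      rintro rfl rfl
      by_contra hq1
      refine h.not_separated_pair (Separated.of_coords (fun _ y => y < q) 1 1 1 n ?_ ?_ ?_)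
      all_goals
        simp only [mem_ell, Set.mem_insert_iff, Set.mem_singleton_iff, Prod.mk.injEq,
          supergrid_adj]
        obtain ⟨rfl, rfl⟩ | ⟨rfl, rfl⟩ : (p = 1 ∧ u = 2) ∨ (p = 2 ∧ u = 1) := by omega
        all_goals omega
    · exact traverses_ell_of_cross ha ham hl hln (by omega) (by omega) (by omega) (by omega)
  · by_cases hv : v ≤ l
    · exact (traverses_ell_of_cross ha ham hl hln (by omega) (by omega) (by omega)
        (by omega)).symm
    · refine traverses_ell_of_bottom ha ham hl hln (by omega) (by omega) (by omega) (by omega)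
        (by omega) ?_
      rintro rfl rfl
      by_contra hp
      refine h.not_separated_pair
        (Separated.of_coords (fun x _ => x < p) 1 (l + 2) m (l + 2) ?_ ?_ ?_)
      all_goals simp only [mem_ell, Set.mem_insert_iff, Set.mem_singleton_iff, Prod.mk.injEq,
        supergrid_adj]
      all_goals omega

theorem traverses_of_reflect {m a l n : ℤ} {s t : ℤ × ℤ}
    (h : Traverses (ell n (n - l) (m - a) m) (reflectL m n s) (reflectL m n t)) :
    Traverses (ell m a l n) s t := by
  simpa only [reflectL_reflectL, sub_sub_cancel] using h.reflect

theorem traverses_ell_iff {m a l n : ℤ} (ha : 1 ≤ a) (ham : a < m) (hl : 1 ≤ l) (hln : l < n)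
    {s t : ℤ × ℤ} (hst : s ≠ t) :
    Traverses (ell m a l n) s t ↔ Admissible m a l n s t := by
  refine ⟨fun h => h.admissible hst, fun h => ?_⟩
  obtain ⟨p, q⟩ := s
  obtain ⟨u, v⟩ := t
  by_cases hcorner : a = m - 1 ∧ l = 1
  · obtain ⟨rfl, rfl⟩ := hcorner
    exact h.traverses_of_corner (by omega) (by omega)
  obtain rfl | ha : a = 1 ∨ 2 ≤ a := by omega
  · exact h.traverses_of_upper_column (by omega) hl hln (by omega)
  have h' := h.reflect
  obtain hn | hn : n - l = 1 ∨ l + 2 ≤ n := by omega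
  · apply traverses_of_reflect
    rw [hn] at h' ⊢
    exact h'.traverses_of_upper_column (by omega) (by omega) (by omega) (by omega)
  obtain rfl | hl : l = 1 ∨ 2 ≤ l := by omega
  · exact traverses_of_reflect (h'.traverses_of_thick (by omega) (by omega) (by omega) (by omega))
  · exact h.traverses_of_thick ha ham hl hn

/-! ### Hamiltonian paths and obstructions in induced subgraphs -/

theorem Traverses.exists_walk {V A : Set (ℤ × ℤ)} {s t : ℤ × ℤ} (h : Traverses A s t)
    (hA : A ⊆ V) : ∃ p : (supergrid.induce V).Walk ⟨s, hA h.start_mem⟩ ⟨t, hA h.end_mem⟩,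
      p.IsPath ∧ ∀ x, x ∈ p.support ↔ (x : ℤ × ℤ) ∈ A := by
  induction h with
  | single v =>
    exact ⟨.nil, .nil, fun x => by simp [Subtype.ext_iff]⟩
  | @cons A u v w hu huv h ih =>
    obtain ⟨p, hp, hpA⟩ := ih fun x hx => hA (Or.inr hx)
    refine ⟨.cons (by simpa using huv) p, ?_, fun x => ?_⟩
    · rw [SimpleGraph.Walk.cons_isPath_iff, hpA]
      exact ⟨hp, hu⟩
    · rw [SimpleGraph.Walk.support_cons, List.mem_cons, hpA, Subtype.ext_iff]
      rfl

theorem traverses_of_isPath {V : Set (ℤ × ℤ)} {s t : V} (p : (supergrid.induce V).Walk s t)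
    (hp : p.IsPath) : Traverses (Subtype.val '' {x | x ∈ p.support}) s t := by
  induction p with
  | nil => simpa using Traverses.single _
  | @cons u v w huv p ih =>
    rw [SimpleGraph.Walk.cons_isPath_iff] at hp
    have := Traverses.cons (u := u.1) (by simpa using hp.2) (by simpa using huv) (ih hp.1)
    convert this using 1
    rw [← Set.image_insert_eq]
    congr 1
    ext x
    simp

theorem exists_isHamiltonian_iff {V : Set (ℤ × ℤ)} {s t : V} :
    (∃ p : (supergrid.induce V).Walk s t, p.IsHamiltonian) ↔ Traverses V s t := by
  constructor
  · rintro ⟨p, hp⟩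
    convert traverses_of_isPath p hp.isPath using 1
    simp [hp.mem_support]
  · intro h
    obtain ⟨p, hp, hpV⟩ := h.exists_walk subset_rfl
    exact ⟨p, hp.isHamiltonian_of_mem fun x => (hpV x).2 x.2⟩

theorem isVertexCut_iff {V : Set (ℤ × ℤ)} {S : Set V} :
    IsVertexCut (supergrid.induce V) S ↔ Separated V (Subtype.val '' S) := by
  have hmem : ∀ x (hx : x ∈ V), x ∈ V \ Subtype.val '' S ↔ (⟨x, hx⟩ : V) ∈ Sᶜ := by
    intro x hx
    simp [hx]
  constructor
  · intro h
    simp only [IsVertexCut, SimpleGraph.Preconnected, not_forall] at h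
    obtain ⟨x, y, hxy⟩ := h
    refine ⟨{z | ∃ (h : z ∈ V) (h' : (⟨z, h⟩ : V) ∈ Sᶜ),
      ((supergrid.induce V).induce Sᶜ).Reachable x ⟨⟨z, h⟩, h'⟩},
      ⟨x, (hmem _ x.1.2).2 x.2, x.1.2, x.2, .rfl⟩,
      ⟨y, (hmem _ y.1.2).2 y.2, fun ⟨_, _, h⟩ => hxy h⟩, ?_⟩
    rintro z hz w hw hzw ⟨hzV, hzS, hr⟩
    refine ⟨hw.1, (hmem _ hw.1).1 hw, hr.trans (SimpleGraph.Adj.reachable ?_)⟩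
    simpa using hzw
  · rintro ⟨B, ⟨x, hx, hxB⟩, ⟨y, hy, hyB⟩, hB⟩ h
    obtain ⟨p⟩ := h ⟨⟨x, hx.1⟩, (hmem _ hx.1).1 hx⟩ ⟨⟨y, hy.1⟩, (hmem _ hy.1).1 hy⟩
    have key : ∀ {v w} (p : ((supergrid.induce V).induce Sᶜ).Walk v w),
        (v : ℤ × ℤ) ∈ B → (w : ℤ × ℤ) ∈ B := by
      intro v w p
      induction p with
      | nil => exact id
      | @cons u v w huv p ih =>
        exact fun hu => ih (hB u.1.1 ((hmem _ u.1.2).2 u.2) v.1.1 ((hmem _ v.1.2).2 v.2)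
          (by simpa using huv) hu)
    exact hyB (key p hxB)

theorem condF1_iff {V : Set (ℤ × ℤ)} {s t : V} : CondF1 (supergrid.induce V) s t ↔
    Separated V {s.1} ∨ Separated V {t.1} ∨ Separated V {s.1, t.1} := by
  simp only [CondF1, IsCutVertex, isVertexCut_iff, Set.image_singleton, Set.image_pair]

theorem condF4_iff {V : Set (ℤ × ℤ)} {s t : V} : CondF4 (supergrid.induce V) s t ↔
    ∃ w ∈ V, w ≠ s.1 ∧ w ≠ t.1 ∧ IsLeaf V w := by
  have hleaf : ∀ w : V, ((supergrid.induce V).neighborSet w).encard = 1 ↔ IsLeaf V w := by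
    intro w
    rw [Set.encard_eq_one]
    constructor
    · rintro ⟨x, hx⟩
      have hx' : ∀ y : V, supergrid.Adj w y ↔ y = x := fun y => by
        simpa using Set.ext_iff.mp hx y
      exact ⟨x, x.2, (hx' x).2 rfl, fun y hy hwy => congrArg Subtype.val ((hx' ⟨y, hy⟩).1 hwy)⟩
    · rintro ⟨x, hx, hwx, huniq⟩
      refine ⟨⟨x, hx⟩, Set.ext fun y =>
        ⟨fun hy => Subtype.ext (huniq y y.2 (by simpa using hy)), ?_⟩⟩
      rintro rfl
      simpa using hwx
  constructor
  · rintro ⟨w, hw, hws, hwt⟩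
    exact ⟨w, w.2, fun h => hws (Subtype.ext h), fun h => hwt (Subtype.ext h), (hleaf w).1 hw⟩
  · rintro ⟨w, hwV, hws, hwt, hw⟩
    exact ⟨⟨w, hwV⟩, (hleaf ⟨w, hwV⟩).2 hw, fun h => hws (congrArg Subtype.val h),
      fun h => hwt (congrArg Subtype.val h)⟩

theorem lShapeVerts_eq_ell (m n k l : ℕ) : lShapeVerts m n k l = ell m (m - k) l n := by
  ext ⟨x, y⟩
  simp only [lShapeVerts, rectVerts, Set.mem_sdiff, Set.mem_ofPred_eq, mem_ell]
  omega

theorem condF5_iff {m n k l : ℕ} {s t : ℤ × ℤ} : CondF5 m n k l s t ↔ Twisted m (m - k) l n s t ∨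
      Twisted n (n - l) (m - (m - k)) m (reflectL m n s) (reflectL m n t) := by
  obtain ⟨p, q⟩ := s
  obtain ⟨u, v⟩ := t
  simp only [CondF5, Twisted, reflectL, Set.pair_eq_pair_iff, Prod.mk.injEq]
  refine or_congr ?_ ⟨?_, ?_⟩
  · rw [or_assoc]
    exact ⟨fun ⟨_, _, _, _, h⟩ => ⟨by omega, by omega, by omega, by omega, h⟩,
      fun ⟨_, _, _, _, h⟩ => ⟨by omega, by omega, by omega, by omega, h⟩⟩
  · rintro ⟨h₁, h₂, h₃, h₄, (h | h) | (h | h)⟩ <;>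
      refine ⟨by omega, by omega, by omega, by omega, ?_⟩
    exacts [Or.inr (Or.inl (by omega)), Or.inl (by omega), Or.inr (Or.inr (Or.inl (by omega))),
      Or.inr (Or.inr (Or.inr (by omega)))]
  · rintro ⟨h₁, h₂, h₃, h₄, h | h | h | h⟩ <;>
      refine ⟨by omega, by omega, by omega, by omega, ?_⟩
    exacts [Or.inl (Or.inr (by omega)), Or.inl (Or.inl (by omega)), Or.inr (Or.inl (by omega)),
      Or.inr (Or.inr (by omega))]

theorem theorem3 (m n k l : ℕ) (hm : 1 < m) (hn : 1 < n) (hk : 1 ≤ k) (hl : 1 ≤ l)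
    (hkm : k < m) (hln : l < n) (s t : lShapeVerts m n k l) (hst : s ≠ t) :
    (∃ p : (lShape m n k l).Walk s t, p.IsHamiltonian) ↔
      ¬ CondF1 (lShape m n k l) s t ∧ ¬ CondF4 (lShape m n k l) s t ∧
        ¬ CondF5 m n k l s t := by
  have hst' : s.1 ≠ t.1 := fun h => hst (Subtype.ext h)
  rw [lShape, exists_isHamiltonian_iff, condF1_iff, condF4_iff, condF5_iff]
  clear hst
  obtain ⟨s, hs⟩ := s
  obtain ⟨t, ht⟩ := t
  dsimp only at hst' ⊢
  rw [lShapeVerts_eq_ell] at hs ht ⊢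
  rw [traverses_ell_iff (by omega) (by omega) (by omega) (by omega) hst']
  constructor
  · intro h
    refine ⟨?_, ?_, ?_⟩
    · rintro (h' | h' | h')
      exacts [h.not_separated_start h', h.not_separated_end h', h.not_separated_pair h']
    · rintro ⟨w, hw, hws, hwt, h'⟩
      exact h.not_leaf w hw hws hwt h'
    · rintro (h' | h')
      exacts [h.not_twisted h', h.not_twisted_reflect h']
  · rintro ⟨h₁, h₄, h₅⟩
    simp only [not_or] at h₁ h₅
    exact ⟨hs, ht, hst', h₁.1, h₁.2.1, h₁.2.2,
      fun w hw hws hwt h' => h₄ ⟨w, hw, hws, hwt, h'⟩, h₅.1, h₅.2⟩
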